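/- Consider the two-dimensional orthant model under its uniform coupling: let $(U_x)_{x\in\mathbb{Z}^2}$ be i.i.d. random variables, uniform on $[0,1]$, on a probability space with measure $\mathbb{P}$, and for $p\in[0,1]$ let $\mathcal{G}_x(p)=\{e_1,e_2\}$ if $U_x<p$ and $\mathcal{G}_x(p)=\{-e_1,-e_2\}$ otherwise. Let $\mathcal{B}_o(p)$ be the backward cluster of the origin $o$, i.e. the set of $x\in\mathbb{Z}^2$ for which there are $n\ge 0$ and $x=x_0,x_1,\dots,x_n=o$ with $x_{i+1}-x_i\in\mathcal{G}_{x_i}(p)$ for $0\le i<n$. Let $p_c$ be the critical probability of oriented site percolation on the triangular lattice: $p_c=\inf\{p\in[0,1]:\mathbb{P}(|\mathbf{C}_o(p)|=\infty)>0\}$, where $\mathbf{C}_o(p)$ is the set of $y\in\mathbb{Z}^2$ for which there are $N\ge 0$ and $o=y_0,y_1,\dots,y_N=y$ with $U_{y_i}<p$ for $0\le i\le N$ and $y_{i+1}-y_i\in\{-e_1,\,e_2,\,e_2-e_1\}$ for $0\le i<N$. If $p_c\le p_1<p_2\le 1$, then $\mathbb{P}$-almost surely on the event $\{|\mathcal{B}_o(p_1)|=\infty\}$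 one has $\mathcal{B}_o(p_1)\supsetneq\mathcal{B}_o(p_2)$. -/

import Mathlib

open MeasureTheory ProbabilityTheory Set

/-- A (two-dimensional) directed environment: each site `x` of `ℤ × ℤ` carries the set of
steps that may be taken from `x`. -/
abbrev DirectedEnv : Type := ℤ × ℤ → Set (ℤ × ℤ)

/-- The local configuration `{↑, →}`. -/
def stepsNE : Set (ℤ × ℤ) := {(0, 1), (1, 0)}

/-- The local configuration `{↓, ←}`. -/
def stepsSW : Set (ℤ × ℤ) := {(0, -1), (-1, 0)}

open Classical in
/-- The environment of the two-dimensional orthant model with parameter `p`, built from the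
site variables `u`: the configuration at `x` is `{↑, →}` if `u x < p`, and `{↓, ←}` otherwise. -/
noncomputable def orthantEnv (u : ℤ × ℤ → ℝ) (p : ℝ) : DirectedEnv :=
  fun x => if u x < p then stepsNE else stepsSW

/-- `x → y`: there is a finite (possibly trivial) path from `x` to `y`, each of whose steps is
allowed by the environment at the site from which the step is taken. -/
def EnvConnected (G : DirectedEnv) (x y : ℤ × ℤ) : Prop :=
  Relation.ReflTransGen (fun a b => b - a ∈ G a) x y

/-- The backward cluster of `y`: the set of all sites that are connected to `y`. -/
def backwardCluster (G : DirectedEnv) (y : ℤ × ℤ) : Set (ℤ × ℤ) :=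
  {x | EnvConnected G x y}

/-- The steps `-e₁`, `e₂`, `e₂ - e₁` of oriented percolation on the triangular lattice. -/
def otspSteps : Set (ℤ × ℤ) := {(-1, 0), (0, 1), (-1, 1)}

/-- The forward cluster of `x` in oriented site percolation on the triangular lattice, where a
site is open when its configuration is `{↑, →}`: the set of endpoints of the finite (possibly
trivial) paths from `x` with steps in `otspSteps`, all of whose sites, including `x` and the
endpoint, are open. It is empty if `x` is not open. -/
def otspCluster (G : DirectedEnv) (x : ℤ × ℤ) : Set (ℤ × ℤ) :=
  {y | G x = stepsNE ∧
    Relation.ReflTransGen (fun a b => b - a ∈ otspSteps ∧ G b = stepsNE) x y}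

/-- The joint law of independent site variables that are uniform on `[0, 1]`. -/
noncomputable def uniformSiteLaw : Measure (ℤ × ℤ → ℝ) :=
  Measure.infinitePi (fun _ : ℤ × ℤ => ProbabilityTheory.cond volume (Icc (0 : ℝ) 1))

/-- The probability that the open cluster of the origin is infinite, in oriented site percolation
on the triangular lattice with occupation probability `p`. -/
noncomputable def otspTheta (p : ℝ) : ENNReal :=
  uniformSiteLaw {u | (otspCluster (orthantEnv u p) (0, 0)).Infinite}

/-- The critical probability `p_c` of oriented site percolation on the triangular lattice. -/
noncomputable def criticalProb : ℝ :=
  sInf {p : ℝ | p ∈ Icc (0 : ℝ) 1 ∧ 0 < otspTheta p}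

/-! Call a site open at level `p` if its variable is below `p`, closed otherwise. The complement of
a backward cluster `B` is exactly a set that the environment cannot leave (`ForwardClosed`), and
oriented triangular paths are the barriers that environment paths cannot cross.

Inclusion. Since `p_c ≥ 1/2`, closed sites at level `p₁` have density at most `1/2` and almost
surely do not percolate. If the complement of an infinite `B(p₁)` were not an upper set, the lower
boundary of `B(p₁)`, made of closed sites, would continue forever to the north-west or to the
south-east, giving closed percolation; if it stopped in both directions, `B(p₁)` would be finite
(`exists_percolates_compl`). So the complement is an upper set. Opening a site only replaces its
down and left steps by up and right steps, which cannot leave an upper set, so `B(p₂) ⊆ B(p₁)`.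

The bound `p_c ≥ 1/2`. If density `1/2` percolated, there would be an open path and, by symmetry, a
closed path below it, both infinite to the north-west. They would keep apart two greedy paths of the
environment (`nwStep_iterate_ne_of_percolates`). But the separation of two greedy paths started on
one diagonal is a lazy symmetric random walk, so they almost surely meet
(`uniformSiteLaw_neverMeet`).

Strictness. Suppose the two clusters equal `B`. As `p₂ > p_c`, a bi-infinite path open at level `p₂`
crosses the positive diagonal and blocks the environment, so `B` is not everything and its outer
boundary is infinite. Seen from level `p₁`, that boundary consists of sites below `p₁`. Seen from
level `p₂`, its sites are only known to be below `p₂`, and almost surely some of infinitely many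
such sites lie in `[p₁, p₂)` (`ae_not_clusterBoundary_subset`), a contradiction. -/

/-- The steps `-e₂`, `e₁`, `e₁ - e₂`: the mirror image of `otspSteps` in the diagonal. -/
def otspStepsSE : Set (ℤ × ℤ) := {(0, -1), (1, 0), (1, -1)}

lemma sub_mem_otspSteps {x y : ℤ × ℤ} : y - x ∈ otspSteps ↔
    y = (x.1 - 1, x.2) ∨ y = (x.1, x.2 + 1) ∨ y = (x.1 - 1, x.2 + 1) := by
  simp only [otspSteps, mem_insert_iff, mem_singleton_iff, Prod.ext_iff, Prod.fst_sub,
    Prod.snd_sub]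
  omega

lemma sub_mem_otspStepsSE {x y : ℤ × ℤ} : y - x ∈ otspStepsSE ↔
    y = (x.1, x.2 - 1) ∨ y = (x.1 + 1, x.2) ∨ y = (x.1 + 1, x.2 - 1) := by
  simp only [otspStepsSE, mem_insert_iff, mem_singleton_iff, Prod.ext_iff, Prod.fst_sub,
    Prod.snd_sub]
  omega

/-! ### Oriented site percolation clusters -/

/-- The forward cluster of `x` in oriented site percolation with steps `D` and open sites `S`. -/
def siteCluster (D S : Set (ℤ × ℤ)) (x : ℤ × ℤ) : Set (ℤ × ℤ) :=
  {y | x ∈ S ∧ Relation.ReflTransGen (fun a b => b - a ∈ D ∧ b ∈ S) x y}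

/-- The forward cluster of `x` is infinite. -/
def Percolates (D S : Set (ℤ × ℤ)) (x : ℤ × ℤ) : Prop := (siteCluster D S x).Infinite

lemma siteCluster_mono {D S T : Set (ℤ × ℤ)} (h : S ⊆ T) (x : ℤ × ℤ) :
    siteCluster D S x ⊆ siteCluster D T x :=
  fun _ hy => ⟨h hy.1, Relation.ReflTransGen.mono (fun _ _ hab => ⟨hab.1, h hab.2⟩) _ _ hy.2⟩

lemma Percolates.mono {D S T : Set (ℤ × ℤ)} (h : S ⊆ T) {x : ℤ × ℤ} (hx : Percolates D S x) :
    Percolates D T x :=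
  Set.Infinite.mono (siteCluster_mono h x) hx

lemma siteCluster_subset {D S : Set (ℤ × ℤ)} (x : ℤ × ℤ) : siteCluster D S x ⊆ S := by
  rintro y ⟨hx, hxy⟩
  induction hxy with
  | refl => exact hx
  | tail _ h _ => exact h.2

lemma siteCluster_trans {D S : Set (ℤ × ℤ)} {x y : ℤ × ℤ} (h : y ∈ siteCluster D S x) :
    siteCluster D S y ⊆ siteCluster D S x :=
  fun _ hz => ⟨h.1, h.2.trans hz.2⟩

lemma Percolates.mem {D S : Set (ℤ × ℤ)} {x : ℤ × ℤ} (hx : Percolates D S x) : x ∈ S :=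
  hx.nonempty.choose_spec.1

lemma Percolates.mem_siteCluster {D S : Set (ℤ × ℤ)} {x : ℤ × ℤ} (hx : Percolates D S x) :
    x ∈ siteCluster D S x := ⟨hx.mem, .refl⟩

lemma Percolates.of_mem_siteCluster {D S : Set (ℤ × ℤ)} {x y : ℤ × ℤ}
    (h : y ∈ siteCluster D S x) (hy : Percolates D S y) : Percolates D S x :=
  Set.Infinite.mono (siteCluster_trans h) hy

/-- A König argument: with finitely many steps, an infinite cluster has an infinite cluster at some
open successor. Infinite clusters thus serve as infinite paths without any path being chosen. -/
lemma percolates_iff_exists_succ {D S : Set (ℤ × ℤ)} (hD : D.Finite) {x : ℤ × ℤ} :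
    Percolates D S x ↔ x ∈ S ∧ ∃ y, y - x ∈ D ∧ Percolates D S y := by
  refine ⟨fun hx => ⟨hx.mem, ?_⟩, ?_⟩
  · by_contra! hfin
    refine hx (((Set.finite_singleton x).union (hD.biUnion (t := fun d => siteCluster D S (x + d))
      fun d hd => ?_)).subset ?_)
    · by_contra h
      exact hfin (x + d) (by simpa using hd) h
    · rintro y ⟨h, hxy⟩
      rcases hxy.cases_head with rfl | ⟨z, hz, hzy⟩
      · exact Or.inl rfl
      · refine Or.inr (mem_biUnion hz.1 ?_)
        rw [add_sub_cancel]
        exact ⟨hz.2, hzy⟩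
  · rintro ⟨hx, y, hy, hyp⟩
    exact hyp.of_mem_siteCluster ⟨hx, .single ⟨hy, hyp.mem⟩⟩

lemma otspSteps_finite : otspSteps.Finite := by simp [otspSteps]

lemma otspStepsSE_finite : otspStepsSE.Finite := by simp [otspStepsSE]

lemma siteCluster_equiv {D D' : Set (ℤ × ℤ)} (e : ℤ × ℤ ≃ ℤ × ℤ)
    (he : ∀ a b, e b - e a ∈ D' ↔ b - a ∈ D) (S : Set (ℤ × ℤ)) (x : ℤ × ℤ) :
    siteCluster D (e ⁻¹' S) x = e ⁻¹' siteCluster D' S (e x) := by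
  ext y
  refine and_congr Iff.rfl ⟨fun h => h.lift e fun a b hab => ⟨(he a b).2 hab.1, hab.2⟩, fun h => ?_⟩
  have := h.lift (p := fun a b => b - a ∈ D ∧ b ∈ e ⁻¹' S) e.symm fun a b hab =>
    ⟨(he _ _).1 (by simpa using hab.1), by simpa using hab.2⟩
  simpa [Function.onFun] using this

lemma percolates_equiv {D D' : Set (ℤ × ℤ)} (e : ℤ × ℤ ≃ ℤ × ℤ)
    (he : ∀ a b, e b - e a ∈ D' ↔ b - a ∈ D) (S : Set (ℤ × ℤ)) (x : ℤ × ℤ) :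
    Percolates D (e ⁻¹' S) x ↔ Percolates D' S (e x) := by
  rw [Percolates, siteCluster_equiv e he, Percolates, ← e.image_symm_eq_preimage,
    Set.infinite_image_iff e.symm.injective.injOn]

lemma swap_sub_mem_otspSteps (a b : ℤ × ℤ) :
    Equiv.prodComm ℤ ℤ b - Equiv.prodComm ℤ ℤ a ∈ otspSteps ↔ b - a ∈ otspStepsSE := by
  rw [sub_mem_otspSteps, sub_mem_otspStepsSE]
  simp only [Equiv.prodComm_apply, Prod.ext_iff, Prod.fst_swap, Prod.snd_swap]
  omega

lemma percolates_swap (S : Set (ℤ × ℤ)) (x : ℤ × ℤ) :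
    Percolates otspStepsSE (Prod.swap ⁻¹' S) x ↔ Percolates otspSteps S x.swap :=
  percolates_equiv (Equiv.prodComm ℤ ℤ) swap_sub_mem_otspSteps S x

lemma percolates_add {D : Set (ℤ × ℤ)} (S : Set (ℤ × ℤ)) (v x : ℤ × ℤ) :
    Percolates D ((· + v) ⁻¹' S) x ↔ Percolates D S (x + v) :=
  percolates_equiv (Equiv.addRight v) (by simp) S x

/-- A set of open sites, each of which has a south-east successor in the set, percolates. -/
lemma percolates_of_forall_exists_succ {S Z : Set (ℤ × ℤ)} (hZ : Z ⊆ S)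
    (h : ∀ z ∈ Z, ∃ w ∈ Z, w - z ∈ otspStepsSE) {z : ℤ × ℤ} (hz : z ∈ Z) :
    Percolates otspStepsSE S z := by
  have key : ∀ n : ℕ, ∃ y ∈ Z, y ∈ siteCluster otspStepsSE S z ∧ z.1 - z.2 + n ≤ y.1 - y.2 := by
    intro n
    induction n with
    | zero => exact ⟨z, hz, ⟨hZ hz, .refl⟩, by simp⟩
    | succ n ih =>
      obtain ⟨y, hy, hzy, hn⟩ := ih
      obtain ⟨w, hw, hyw⟩ := h y hy
      refine ⟨w, hw, ⟨hzy.1, hzy.2.tail ⟨hyw, hZ hw⟩⟩, ?_⟩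
      rcases sub_mem_otspStepsSE.1 hyw with rfl | rfl | rfl <;> push_cast <;> omega
  intro hfin
  obtain ⟨c, hc⟩ := (hfin.image fun y : ℤ × ℤ => y.1 - y.2).bddAbove
  obtain ⟨y, -, hy, hn⟩ := key (c - (z.1 - z.2) + 1).toNat
  have := hc (mem_image_of_mem _ hy)
  omega

/-! ### Staircases and the sets above and below them -/

/-- Follow successors from some `g ≤ x` while they go straight up. Either one moves west no higher
than `x`, or the row of `x` is reached at a site other than `x`, hence to its left. Thus a leftward
step out of the region above `K` can only start on `K`. -/
lemma left_mem_upperClosure {K : Set (ℤ × ℤ)} (h : ∀ g ∈ K, ∃ w ∈ K, w - g ∈ otspSteps)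
    {x : ℤ × ℤ} (hx : x ∈ upperClosure K) (hxK : x ∉ K) : (x.1 - 1, x.2) ∈ upperClosure K := by
  obtain ⟨g, hg, hgx⟩ := mem_upperClosure.1 hx
  obtain ⟨n, hn⟩ : ∃ n : ℕ, x.2 - g.2 = n := ⟨_, (Int.toNat_of_nonneg (by have := hgx.2; omega)).symm⟩
  induction n generalizing g with
  | zero =>
    refine mem_upperClosure.2 ⟨g, hg, ?_⟩
    have : g.1 ≠ x.1 := fun h1 => hxK ((Prod.ext h1 (by omega) : g = x) ▸ hg)
    have := hgx.1
    exact Prod.mk_le_mk.2 ⟨by omega, by omega⟩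
  | succ n ih =>
    obtain ⟨h1, h2⟩ := hgx
    obtain ⟨w, hw, hgw⟩ := h g hg
    rcases sub_mem_otspSteps.1 hgw with rfl | rfl | rfl
    · exact mem_upperClosure.2 ⟨_, hw, Prod.mk_le_mk.2 ⟨by omega, by omega⟩⟩
    · exact ih _ hw ⟨h1, by push_cast at hn; dsimp only; omega⟩ (by push_cast at hn ⊢; omega)
    · exact mem_upperClosure.2 ⟨_, hw, Prod.mk_le_mk.2 ⟨by omega, by omega⟩⟩

lemma swap_mem_upperClosure {K : Set (ℤ × ℤ)} {x : ℤ × ℤ} :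
    x.swap ∈ upperClosure (Prod.swap ⁻¹' K) ↔ x ∈ upperClosure K := by
  simp only [mem_upperClosure, mem_preimage, Prod.le_def, Prod.fst_swap, Prod.snd_swap]
  exact ⟨fun ⟨g, hg, h⟩ => ⟨g.swap, hg, h.symm⟩, fun ⟨g, hg, h⟩ => ⟨g.swap, by simpa, h.symm⟩⟩

lemma neg_mem_upperClosure {K : Set (ℤ × ℤ)} {x : ℤ × ℤ} :
    -x ∈ upperClosure (-K) ↔ x ∈ lowerClosure K := by
  simp only [mem_upperClosure, mem_lowerClosure, Set.mem_neg]
  exact ⟨fun ⟨g, hg, h⟩ => ⟨-g, hg, le_neg_of_le_neg h⟩, fun ⟨g, hg, h⟩ => ⟨-g, by simpa, by simpa⟩⟩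

lemma down_mem_upperClosure {K : Set (ℤ × ℤ)} (h : ∀ g ∈ K, ∃ w ∈ K, w - g ∈ otspStepsSE)
    {x : ℤ × ℤ} (hx : x ∈ upperClosure K) (hxK : x ∉ K) : (x.1, x.2 - 1) ∈ upperClosure K := by
  rw [← swap_mem_upperClosure] at hx ⊢
  refine left_mem_upperClosure (fun g hg => ?_) hx (by simpa)
  obtain ⟨w, hw, hgw⟩ := h _ hg
  exact ⟨w.swap, by simpa, (swap_sub_mem_otspSteps g.swap w).2 hgw⟩

lemma neg_sub_mem_otspSteps {a b : ℤ × ℤ} : b - a ∈ otspSteps ↔ -b - -a ∈ otspStepsSE := by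
  rw [sub_mem_otspSteps, sub_mem_otspStepsSE]
  simp only [Prod.ext_iff, Prod.fst_neg, Prod.snd_neg]
  omega

lemma right_mem_lowerClosure {K : Set (ℤ × ℤ)} (h : ∀ g ∈ K, ∃ w ∈ K, w - g ∈ otspStepsSE)
    {x : ℤ × ℤ} (hx : x ∈ lowerClosure K) (hxK : x ∉ K) : (x.1 + 1, x.2) ∈ lowerClosure K := by
  rw [← neg_mem_upperClosure] at hx ⊢
  have := left_mem_upperClosure (fun g hg => ?_) hx (by simpa)
  · convert this using 1
    ext <;> simp; ring
  · obtain ⟨w, hw, hgw⟩ := h _ hg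
    exact ⟨-w, by simpa, neg_sub_mem_otspSteps.2 (by simpa using hgw)⟩

lemma up_mem_lowerClosure {K : Set (ℤ × ℤ)} (h : ∀ g ∈ K, ∃ w ∈ K, w - g ∈ otspSteps)
    {x : ℤ × ℤ} (hx : x ∈ lowerClosure K) (hxK : x ∉ K) : (x.1, x.2 + 1) ∈ lowerClosure K := by
  rw [← neg_mem_upperClosure] at hx ⊢
  have := down_mem_upperClosure (fun g hg => ?_) hx (by simpa)
  · convert this using 1
    ext <;> simp; ring
  · obtain ⟨w, hw, hgw⟩ := h _ hg
    exact ⟨-w, by simpa, by simpa using neg_sub_mem_otspSteps.1 hgw⟩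

/-! ### Environments given by their set of open sites -/

open Classical in
/-- The environment whose configuration is `{↑, →}` on `S` and `{↓, ←}` off `S`. -/
noncomputable def sitesEnv (S : Set (ℤ × ℤ)) : DirectedEnv :=
  fun x => if x ∈ S then stepsNE else stepsSW

lemma orthantEnv_eq_sitesEnv (u : ℤ × ℤ → ℝ) (p : ℝ) : orthantEnv u p = sitesEnv {x | u x < p} := by
  ext1 x
  simp [orthantEnv, sitesEnv]

lemma stepsSW_ne_stepsNE : stepsSW ≠ stepsNE := fun h => by
  have : ((0, 1) : ℤ × ℤ) ∈ stepsSW := h ▸ by simp [stepsNE]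
  simp [stepsSW] at this

lemma sitesEnv_eq_stepsNE {S : Set (ℤ × ℤ)} {x : ℤ × ℤ} : sitesEnv S x = stepsNE ↔ x ∈ S := by
  by_cases h : x ∈ S <;> simp [sitesEnv, h, stepsSW_ne_stepsNE]

lemma otspCluster_orthantEnv (u : ℤ × ℤ → ℝ) (p : ℝ) (x : ℤ × ℤ) :
    otspCluster (orthantEnv u p) x = siteCluster otspSteps {x | u x < p} x := by
  simp only [otspCluster, orthantEnv_eq_sitesEnv, sitesEnv_eq_stepsNE, siteCluster]

lemma sub_mem_sitesEnv {S : Set (ℤ × ℤ)} {x y : ℤ × ℤ} : y - x ∈ sitesEnv S x ↔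
    (x ∈ S ∧ (y = (x.1, x.2 + 1) ∨ y = (x.1 + 1, x.2))) ∨
      (x ∉ S ∧ (y = (x.1, x.2 - 1) ∨ y = (x.1 - 1, x.2))) := by
  by_cases h : x ∈ S <;>
    simp only [sitesEnv, h, if_true, if_false, stepsNE, stepsSW, mem_insert_iff,
      mem_singleton_iff, Prod.ext_iff, Prod.fst_sub, Prod.snd_sub, true_and, false_and, or_false,
      false_or, not_true, not_false_iff] <;> omega

/-- No step of the environment leads out of `A`. -/
def ForwardClosed (S A : Set (ℤ × ℤ)) : Prop :=
  ∀ ⦃x⦄, x ∈ A → ∀ ⦃y⦄, y - x ∈ sitesEnv S x → y ∈ A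

lemma forwardClosed_compl_backwardCluster (S : Set (ℤ × ℤ)) (t : ℤ × ℤ) :
    ForwardClosed S (backwardCluster (sitesEnv S) t)ᶜ :=
  fun _ hx _ hxy hy => hx (Relation.ReflTransGen.head hxy hy)

lemma ForwardClosed.subset_compl_backwardCluster {S A : Set (ℤ × ℤ)} (h : ForwardClosed S A)
    {t : ℤ × ℤ} (ht : t ∉ A) : A ⊆ (backwardCluster (sitesEnv S) t)ᶜ := by
  intro x hx hxt
  change Relation.ReflTransGen _ x t at hxt
  refine ht ?_
  clear ht
  induction hxt with
  | refl => exact hx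
  | tail _ hstep ih => exact h ih hstep

lemma self_mem_backwardCluster (G : DirectedEnv) (t : ℤ × ℤ) : t ∈ backwardCluster G t :=
  Relation.ReflTransGen.refl

section Steps

variable {S A : Set (ℤ × ℤ)} (h : ForwardClosed S A) {x : ℤ × ℤ}
include h

lemma ForwardClosed.up (hx : x ∈ A) (hS : x ∈ S) : (x.1, x.2 + 1) ∈ A :=
  h hx (sub_mem_sitesEnv.2 (Or.inl ⟨hS, Or.inl rfl⟩))

lemma ForwardClosed.right (hx : x ∈ A) (hS : x ∈ S) : (x.1 + 1, x.2) ∈ A :=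
  h hx (sub_mem_sitesEnv.2 (Or.inl ⟨hS, Or.inr rfl⟩))

lemma ForwardClosed.down (hx : x ∈ A) (hS : x ∉ S) : (x.1, x.2 - 1) ∈ A :=
  h hx (sub_mem_sitesEnv.2 (Or.inr ⟨hS, Or.inl rfl⟩))

lemma ForwardClosed.left (hx : x ∈ A) (hS : x ∉ S) : (x.1 - 1, x.2) ∈ A :=
  h hx (sub_mem_sitesEnv.2 (Or.inr ⟨hS, Or.inr rfl⟩))

end Steps

/-- The up and right steps of newly opened sites stay in an upper set; sites still closed keep their
old steps. -/
lemma ForwardClosed.mono {S T A : Set (ℤ × ℤ)} (h : ForwardClosed S A) (hA : IsUpperSet A)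
    (hST : S ⊆ T) : ForwardClosed T A := by
  intro x hx y hy
  rcases sub_mem_sitesEnv.1 hy with ⟨-, rfl | rfl⟩ | ⟨hT, rfl | rfl⟩
  · exact hA (Prod.mk_le_mk.2 ⟨le_rfl, by omega⟩ : x ≤ _) hx
  · exact hA (Prod.mk_le_mk.2 ⟨by omega, le_rfl⟩ : x ≤ _) hx
  · exact h.down hx fun hS => hT (hST hS)
  · exact h.left hx fun hS => hT (hST hS)

/-- If the complement of a backward cluster is an upper set, then opening more sites can only
shrink the backward cluster. -/
lemma backwardCluster_subset_of_isUpperSet {S T : Set (ℤ × ℤ)} {t : ℤ × ℤ}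
    (hA : IsUpperSet (backwardCluster (sitesEnv S) t)ᶜ) (hST : S ⊆ T) :
    backwardCluster (sitesEnv T) t ⊆ backwardCluster (sitesEnv S) t :=
  compl_subset_compl.1 (((forwardClosed_compl_backwardCluster S t).mono hA
    hST).subset_compl_backwardCluster fun h => h (self_mem_backwardCluster _ t))

lemma isUpperSet_of_forall {A : Set (ℤ × ℤ)} (h : ∀ x ∈ A, (x.1 + 1, x.2) ∈ A ∧ (x.1, x.2 + 1) ∈ A) :
    IsUpperSet A := by
  have right : ∀ n : ℕ, ∀ x ∈ A, (x.1 + n, x.2) ∈ A := fun n x hx => by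
    induction n with
    | zero => simpa
    | succ n ih => simpa [add_assoc] using (h _ ih).1
  have up : ∀ n : ℕ, ∀ x ∈ A, (x.1, x.2 + n) ∈ A := fun n x hx => by
    induction n with
    | zero => simpa
    | succ n ih => simpa [add_assoc] using (h _ ih).2
  intro x y hxy hx
  have := up (y.2 - x.2).toNat _ (right (y.1 - x.1).toNat x hx)
  convert this using 1
  have h1 := hxy.1
  have h2 := hxy.2
  exact Prod.ext (by simp; omega) (by simp; omega)

/-! ### Bi-infinite open paths block the environment -/

lemma siteCluster_otspSteps_le {S : Set (ℤ × ℤ)} {x y : ℤ × ℤ} (h : y ∈ siteCluster otspSteps S x) :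
    y.1 ≤ x.1 ∧ x.2 ≤ y.2 := by
  obtain ⟨-, h⟩ := h
  induction h with
  | refl => exact ⟨le_rfl, le_rfl⟩
  | tail _ h ih => rcases sub_mem_otspSteps.1 h.1 with rfl | rfl | rfl <;> constructor <;> simp <;> omega

lemma siteCluster_otspStepsSE_le {S : Set (ℤ × ℤ)} {x y : ℤ × ℤ}
    (h : y ∈ siteCluster otspStepsSE S x) : x.1 ≤ y.1 ∧ y.2 ≤ x.2 := by
  obtain ⟨-, h⟩ := h
  induction h with
  | refl => exact ⟨le_rfl, le_rfl⟩
  | tail _ h ih => rcases sub_mem_otspStepsSE.1 h.1 with rfl | rfl | rfl <;> constructor <;> simp <;> omega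

/-- The sites of the cluster of `x` that percolate. -/
def percolatingPart (D S : Set (ℤ × ℤ)) (x : ℤ × ℤ) : Set (ℤ × ℤ) :=
  {y ∈ siteCluster D S x | Percolates D S y}

lemma percolatingPart_exists_succ {D S : Set (ℤ × ℤ)} (hD : D.Finite) {x y : ℤ × ℤ}
    (hy : y ∈ percolatingPart D S x) : ∃ w ∈ percolatingPart D S x, w - y ∈ D := by
  obtain ⟨hyS, w, hw, hp⟩ := (percolates_iff_exists_succ hD).1 hy.2
  exact ⟨w, ⟨siteCluster_trans hy.1 ⟨hyS, .single ⟨hw, hp.mem⟩⟩, hp⟩, hw⟩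

lemma percolatingPart_exists_pred {D S : Set (ℤ × ℤ)} {x y : ℤ × ℤ}
    (hy : y ∈ percolatingPart D S x) (hyx : y ≠ x) :
    ∃ w ∈ percolatingPart D S x, y - w ∈ D := by
  obtain ⟨⟨hx, hxy⟩, hp⟩ := hy
  rcases hxy.cases_tail with rfl | ⟨w, hxw, hwy⟩
  · exact absurd rfl hyx
  · have hw : w ∈ siteCluster D S x := ⟨hx, hxw⟩
    exact ⟨w, ⟨hw, hp.of_mem_siteCluster ⟨siteCluster_subset x hw, .single hwy⟩⟩, hwy.1⟩

/-- Two infinite arms in opposite directions act as a bi-infinite path: go outwards along the `D`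
arm, and along the `D'` arm retreat through predecessors to `x`, where the `D` arm takes over. -/
lemma percolatingPart_union_exists {D D' S : Set (ℤ × ℤ)} (hD : D.Finite)
    (hDD : ∀ a b : ℤ × ℤ, a - b ∈ D' → b - a ∈ D) {x : ℤ × ℤ} (hx : Percolates D S x) :
    ∀ g ∈ percolatingPart D S x ∪ percolatingPart D' S x,
      ∃ w ∈ percolatingPart D S x ∪ percolatingPart D' S x, w - g ∈ D := by
  have key : ∀ g ∈ percolatingPart D S x,
      ∃ w ∈ percolatingPart D S x ∪ percolatingPart D' S x, w - g ∈ D := fun g hg => by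
    obtain ⟨w, hw, hgw⟩ := percolatingPart_exists_succ hD hg
    exact ⟨w, Or.inl hw, hgw⟩
  rintro g (hg | hg)
  · exact key g hg
  · rcases eq_or_ne g x with rfl | hgx
    · exact key g ⟨hx.mem_siteCluster, hx⟩
    · obtain ⟨w, hw, hgw⟩ := percolatingPart_exists_pred hg hgx
      exact ⟨w, Or.inr hw, hDD _ _ hgw⟩

lemma otspSteps_neg {a b : ℤ × ℤ} : a - b ∈ otspStepsSE ↔ b - a ∈ otspSteps := by
  rw [sub_mem_otspSteps, sub_mem_otspStepsSE]
  simp only [Prod.ext_iff]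
  omega

/-- The region weakly above a bi-infinite open path is forward closed, since down and left steps
start only at closed sites, hence off the path. The origin is outside: one arm stays at height at
least `n`, the other at abscissa at least `n`. -/
lemma notMem_backwardCluster_of_percolates {S : Set (ℤ × ℤ)} {n : ℤ} (hn : 0 < n)
    (h₁ : Percolates otspSteps S (n, n)) (h₂ : Percolates otspStepsSE S (n, n)) :
    (n, n) ∉ backwardCluster (sitesEnv S) (0, 0) := by
  set K := percolatingPart otspSteps S (n, n) ∪ percolatingPart otspStepsSE S (n, n) with hK
  have hNW : ∀ g ∈ K, ∃ w ∈ K, w - g ∈ otspSteps :=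
    percolatingPart_union_exists otspSteps_finite (fun _ _ => otspSteps_neg.1) h₁
  have hSE : ∀ g ∈ K, ∃ w ∈ K, w - g ∈ otspStepsSE := by
    rw [hK, union_comm]
    exact percolatingPart_union_exists otspStepsSE_finite (fun _ _ => otspSteps_neg.2) h₂
  have hKS : K ⊆ S := union_subset (fun y hy => hy.2.mem) fun y hy => hy.2.mem
  have hclosed : ForwardClosed S (upperClosure K : Set (ℤ × ℤ)) := by
    intro x hx y hy
    rcases sub_mem_sitesEnv.1 hy with ⟨-, rfl | rfl⟩ | ⟨hS, rfl | rfl⟩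
    · exact (upperClosure K).upper (Prod.mk_le_mk.2 ⟨le_rfl, by omega⟩ : x ≤ _) hx
    · exact (upperClosure K).upper (Prod.mk_le_mk.2 ⟨by omega, le_rfl⟩ : x ≤ _) hx
    · exact down_mem_upperClosure hSE hx fun h => hS (hKS h)
    · exact left_mem_upperClosure hNW hx fun h => hS (hKS h)
  refine hclosed.subset_compl_backwardCluster ?_
    (subset_upperClosure (Or.inl ⟨h₁.mem_siteCluster, h₁⟩))
  intro h
  obtain ⟨g, hg | hg, hg0⟩ := mem_upperClosure.1 h
  · have := (siteCluster_otspSteps_le hg.1).2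
    have := hg0.2
    simp at *
    omega
  · have := (siteCluster_otspStepsSE_le hg.1).1
    have := hg0.1
    simp at *
    omega

/-! ### The boundary of a backward cluster -/

/-- The sites outside `B` whose left or lower neighbour is in `B`. -/
def outerBoundary (B : Set (ℤ × ℤ)) : Set (ℤ × ℤ) :=
  {x | x ∉ B ∧ ((x.1 - 1, x.2) ∈ B ∨ (x.1, x.2 - 1) ∈ B)}

/-- A closed boundary site could step left and down, hence into `B`. -/
lemma ForwardClosed.outerBoundary_subset {S B : Set (ℤ × ℤ)} (h : ForwardClosed S Bᶜ) :
    outerBoundary B ⊆ S := by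
  rintro x ⟨hx, hx'⟩
  by_contra hS
  rcases hx' with hx' | hx'
  · exact h.left hx hS hx'
  · exact h.down hx hS hx'

lemma outerBoundary_infinite {B : Set (ℤ × ℤ)} (hB : IsUpperSet Bᶜ) {a b : ℤ × ℤ} (ha : a ∈ B)
    (hb : b ∉ B) : (outerBoundary B).Infinite := by
  have hlow : IsLowerSet B := by simpa using hB.compl
  have key : ∀ d : ℤ, ∃ x ∈ outerBoundary B, d - 1 ≤ x.1 - x.2 := by
    intro d
    -- Take the first site outside `B` on the diagonal `d`. Its left neighbour is either in `B`, or
    -- is itself a boundary site, lying on the diagonal `d - 1`.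
    obtain ⟨t, ht, hmin⟩ := Int.exists_least_of_bdd (P := fun t => (t + d, t) ∉ B)
      ⟨min (a.1 - d) a.2, fun t ht => by
        by_contra hlt
        refine ht (hlow (Prod.mk_le_mk.2 ⟨?_, ?_⟩ : _ ≤ a) ha) <;> omega⟩
      ⟨max (b.1 - d) b.2, hB (Prod.mk_le_mk.2 ⟨by omega, by omega⟩ : b ≤ _) hb⟩
    have ht' : (t - 1 + d, t - 1) ∈ B := by
      by_contra h
      have := hmin _ h
      omega
    by_cases h : (t + d - 1, t) ∈ B
    · exact ⟨(t + d, t), ⟨ht, Or.inl h⟩, by simp⟩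
    · refine ⟨(t + d - 1, t), ⟨h, Or.inr ?_⟩, by dsimp only; omega⟩
      convert ht' using 2
      ring
  intro hfin
  obtain ⟨c, hc⟩ := (hfin.image fun y : ℤ × ℤ => y.1 - y.2).bddAbove
  obtain ⟨x, hx, hd⟩ := key (c + 2)
  have := hc (mem_image_of_mem _ hx)
  omega

/-! ### The greedy north-west and south-east paths of an environment -/

open Classical in
/-- The step of the environment that goes north or west. -/
noncomputable def nwStep (S : Set (ℤ × ℤ)) (x : ℤ × ℤ) : ℤ × ℤ :=
  if x ∈ S then (x.1, x.2 + 1) else (x.1 - 1, x.2)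

open Classical in
/-- The step of the environment that goes south or east. -/
noncomputable def seStep (S : Set (ℤ × ℤ)) (x : ℤ × ℤ) : ℤ × ℤ :=
  if x ∈ S then (x.1 + 1, x.2) else (x.1, x.2 - 1)

section Steps

variable {S : Set (ℤ × ℤ)} {x : ℤ × ℤ}

lemma nwStep_of_mem (h : x ∈ S) : nwStep S x = (x.1, x.2 + 1) := by
  simp [nwStep, h]

lemma nwStep_of_notMem (h : x ∉ S) : nwStep S x = (x.1 - 1, x.2) := by
  simp [nwStep, h]

lemma seStep_of_mem (h : x ∈ S) : seStep S x = (x.1 + 1, x.2) := by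
  simp [seStep, h]

lemma seStep_of_notMem (h : x ∉ S) : seStep S x = (x.1, x.2 - 1) := by
  simp [seStep, h]

lemma nwStep_cases (S : Set (ℤ × ℤ)) (x : ℤ × ℤ) :
    nwStep S x = (x.1, x.2 + 1) ∨ nwStep S x = (x.1 - 1, x.2) := by
  by_cases h : x ∈ S <;> simp [nwStep, h]

lemma seStep_cases (S : Set (ℤ × ℤ)) (x : ℤ × ℤ) :
    seStep S x = (x.1 + 1, x.2) ∨ seStep S x = (x.1, x.2 - 1) := by
  by_cases h : x ∈ S <;> simp [seStep, h]

lemma nwStep_sub_mem : nwStep S x - x ∈ otspSteps := by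
  rw [sub_mem_otspSteps]
  rcases nwStep_cases S x with h | h <;> simp [h]

lemma seStep_sub_mem : seStep S x - x ∈ otspStepsSE := by
  rw [sub_mem_otspStepsSE]
  rcases seStep_cases S x with h | h <;> simp [h]

lemma nwStep_iterate_le (k : ℕ) : ((nwStep S)^[k] x).1 ≤ x.1 ∧ x.2 ≤ ((nwStep S)^[k] x).2 := by
  induction k with
  | zero => simp
  | succ k ih =>
    rw [Function.iterate_succ_apply']
    rcases nwStep_cases S ((nwStep S)^[k] x) with h | h <;> rw [h] <;> constructor <;> simp <;> omega

lemma seStep_iterate_le (k : ℕ) : x.1 ≤ ((seStep S)^[k] x).1 ∧ ((seStep S)^[k] x).2 ≤ x.2 := by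
  induction k with
  | zero => simp
  | succ k ih =>
    rw [Function.iterate_succ_apply']
    rcases seStep_cases S ((seStep S)^[k] x) with h | h <;> rw [h] <;> constructor <;> simp <;> omega

/-- Each step crosses to the next diagonal, so the path never revisits a diagonal and always reads
fresh site variables. -/
lemma nwStep_iterate_column (k : ℕ) :
    ((nwStep S)^[k] x).1 - ((nwStep S)^[k] x).2 = x.1 - x.2 - k := by
  induction k with
  | zero => simp
  | succ k ih =>
    rw [Function.iterate_succ_apply']
    rcases nwStep_cases S ((nwStep S)^[k] x) with h | h <;> rw [h] <;> push_cast <;> omega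

lemma seStep_iterate_column (k : ℕ) :
    ((seStep S)^[k] x).1 - ((seStep S)^[k] x).2 = x.1 - x.2 + k := by
  induction k with
  | zero => simp
  | succ k ih =>
    rw [Function.iterate_succ_apply']
    rcases seStep_cases S ((seStep S)^[k] x) with h | h <;> rw [h] <;> push_cast <;> omega

lemma ForwardClosed.nwStep_iterate_mem {A : Set (ℤ × ℤ)} (h : ForwardClosed S A) (hx : x ∈ A)
    (k : ℕ) : (nwStep S)^[k] x ∈ A := by
  induction k with
  | zero => exact hx
  | succ k ih =>
    rw [Function.iterate_succ_apply']
    by_cases hS : (nwStep S)^[k] x ∈ S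
    · exact nwStep_of_mem hS ▸ h.up ih hS
    · exact nwStep_of_notMem hS ▸ h.left ih hS

lemma ForwardClosed.seStep_iterate_mem {A : Set (ℤ × ℤ)} (h : ForwardClosed S A) (hx : x ∈ A)
    (k : ℕ) : (seStep S)^[k] x ∈ A := by
  induction k with
  | zero => exact hx
  | succ k ih =>
    rw [Function.iterate_succ_apply']
    by_cases hS : (seStep S)^[k] x ∈ S
    · exact seStep_of_mem hS ▸ h.right ih hS
    · exact seStep_of_notMem hS ▸ h.down ih hS

end Steps

/-- The union of the greedy north-west path from `a` and of the greedy south-east path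
from `b`. -/
def staircase (S : Set (ℤ × ℤ)) (a b : ℤ × ℤ) : Set (ℤ × ℤ) :=
  range (fun k => (nwStep S)^[k] a) ∪ range (fun k => (seStep S)^[k] b)

section Staircase

variable {S : Set (ℤ × ℤ)} {a b : ℤ × ℤ}

lemma staircase_exists_nw (hab : b - a ∈ otspStepsSE) :
    ∀ g ∈ staircase S a b, ∃ w ∈ staircase S a b, w - g ∈ otspSteps := by
  rintro _ (⟨k, rfl⟩ | ⟨k, rfl⟩)
  · refine ⟨_, Or.inl ⟨k + 1, rfl⟩, ?_⟩
    simp only [Function.iterate_succ_apply']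
    exact nwStep_sub_mem
  · cases k with
    | zero => exact ⟨a, Or.inl ⟨0, rfl⟩, otspSteps_neg.1 hab⟩
    | succ k =>
      refine ⟨_, Or.inr ⟨k, rfl⟩, ?_⟩
      simp only [Function.iterate_succ_apply']
      exact otspSteps_neg.1 seStep_sub_mem

lemma staircase_exists_se (hab : b - a ∈ otspStepsSE) :
    ∀ g ∈ staircase S a b, ∃ w ∈ staircase S a b, w - g ∈ otspStepsSE := by
  rintro _ (⟨k, rfl⟩ | ⟨k, rfl⟩)
  · cases k with
    | zero => exact ⟨b, Or.inr ⟨0, rfl⟩, hab⟩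
    | succ k =>
      refine ⟨_, Or.inl ⟨k, rfl⟩, ?_⟩
      simp only [Function.iterate_succ_apply']
      exact otspSteps_neg.2 nwStep_sub_mem
  · refine ⟨_, Or.inr ⟨k + 1, rfl⟩, ?_⟩
    simp only [Function.iterate_succ_apply']
    exact seStep_sub_mem

lemma staircase_column (hab : b.1 - b.2 ≤ a.1 - a.2 + 1) (d : ℤ) :
    ∃ g ∈ staircase S a b, g.1 - g.2 = d := by
  by_cases h : d ≤ a.1 - a.2
  · refine ⟨_, Or.inl ⟨(a.1 - a.2 - d).toNat, rfl⟩, ?_⟩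
    have := nwStep_iterate_column (S := S) (x := a) (a.1 - a.2 - d).toNat
    dsimp only
    omega
  · refine ⟨_, Or.inr ⟨(d - (b.1 - b.2)).toNat, rfl⟩, ?_⟩
    have := seStep_iterate_column (S := S) (x := b) (d - (b.1 - b.2)).toNat
    dsimp only
    omega

lemma ForwardClosed.staircase_subset {A : Set (ℤ × ℤ)} (h : ForwardClosed S A) (ha : a ∈ A)
    (hb : b ∈ A) : staircase S a b ⊆ A := by
  rintro _ (⟨k, rfl⟩ | ⟨k, rfl⟩)
  · exact h.nwStep_iterate_mem ha k
  · exact h.seStep_iterate_mem hb k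

end Staircase

section Separation

variable {S K : Set (ℤ × ℤ)} {t x : ℤ × ℤ} (hNW : ∀ g ∈ K, ∃ w ∈ K, w - g ∈ otspSteps)
  (hSE : ∀ g ∈ K, ∃ w ∈ K, w - g ∈ otspStepsSE) (hK : K ⊆ (backwardCluster (sitesEnv S) t)ᶜ)
include hNW hSE hK

/-- A path to `t` stays in the cluster and so avoids `K`; a unit step that avoids `K` cannot change
sides of this bi-infinite staircase, whatever the site configurations. -/
lemma mem_upperClosure_iff_of_mem_backwardCluster (hx : x ∈ backwardCluster (sitesEnv S) t) :
    x ∈ upperClosure K ↔ t ∈ upperClosure K := by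
  change Relation.ReflTransGen _ x t at hx
  induction hx using Relation.ReflTransGen.head_induction_on with
  | refl => rfl
  | @head a c hac hct ih =>
    rw [← ih]
    have ha : a ∉ K := fun h => hK h (hct.head hac)
    have hc : c ∉ K := fun h => hK h hct
    rcases sub_mem_sitesEnv.1 hac with ⟨-, rfl | rfl⟩ | ⟨-, rfl | rfl⟩
    · exact ⟨(upperClosure K).upper (Prod.mk_le_mk.2 ⟨le_rfl, by omega⟩ : a ≤ _),
        fun h => by simpa using down_mem_upperClosure hSE h hc⟩
    · exact ⟨(upperClosure K).upper (Prod.mk_le_mk.2 ⟨by omega, le_rfl⟩ : a ≤ _),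
        fun h => by simpa using left_mem_upperClosure hNW h hc⟩
    · exact ⟨fun h => down_mem_upperClosure hSE h ha,
        (upperClosure K).upper (Prod.mk_le_mk.2 ⟨le_rfl, by omega⟩ : _ ≤ (a.1, a.2))⟩
    · exact ⟨fun h => left_mem_upperClosure hNW h ha,
        (upperClosure K).upper (Prod.mk_le_mk.2 ⟨by omega, le_rfl⟩ : _ ≤ (a.1, a.2))⟩

lemma mem_lowerClosure_iff_of_mem_backwardCluster (hx : x ∈ backwardCluster (sitesEnv S) t) :
    x ∈ lowerClosure K ↔ t ∈ lowerClosure K := by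
  change Relation.ReflTransGen _ x t at hx
  induction hx using Relation.ReflTransGen.head_induction_on with
  | refl => rfl
  | @head a c hac hct ih =>
    rw [← ih]
    have ha : a ∉ K := fun h => hK h (hct.head hac)
    have hc : c ∉ K := fun h => hK h hct
    rcases sub_mem_sitesEnv.1 hac with ⟨-, rfl | rfl⟩ | ⟨-, rfl | rfl⟩
    · exact ⟨fun h => up_mem_lowerClosure hNW h ha,
        (lowerClosure K).lower (Prod.mk_le_mk.2 ⟨le_rfl, by omega⟩ : (a.1, a.2) ≤ _)⟩
    · exact ⟨fun h => right_mem_lowerClosure hSE h ha,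
        (lowerClosure K).lower (Prod.mk_le_mk.2 ⟨by omega, le_rfl⟩ : (a.1, a.2) ≤ _)⟩
    · exact ⟨(lowerClosure K).lower (Prod.mk_le_mk.2 ⟨le_rfl, by omega⟩ : _ ≤ (a.1, a.2)),
        fun h => by simpa using up_mem_lowerClosure hNW h hc⟩
    · exact ⟨(lowerClosure K).lower (Prod.mk_le_mk.2 ⟨by omega, le_rfl⟩ : _ ≤ (a.1, a.2)),
        fun h => by simpa using right_mem_lowerClosure hSE h hc⟩

end Separation

/-! ### Infinite backward clusters and closed paths -/

/-- If the lower boundary of a backward cluster stops at `z` on its way to the south-east, then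
the cluster does not extend further in this direction, and meets each diagonal in a finite set. -/
lemma backwardCluster_bounded_of_pinch {S : Set (ℤ × ℤ)} {t z : ℤ × ℤ}
    (hz : z ∉ backwardCluster (sitesEnv S) t)
    (hu : (z.1, z.2 + 1) ∈ backwardCluster (sitesEnv S) t)
    (hr : (z.1 + 1, z.2) ∉ backwardCluster (sitesEnv S) t)
    (hru : (z.1 + 1, z.2 + 1) ∉ backwardCluster (sitesEnv S) t) :
    (∀ x ∈ backwardCluster (sitesEnv S) t, x.1 - x.2 ≤ z.1 - z.2) ∧
      ∀ d, {x ∈ backwardCluster (sitesEnv S) t | x.1 - x.2 = d}.Finite := by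
  set B := backwardCluster (sitesEnv S) t
  have hfc : ForwardClosed S Bᶜ := forwardClosed_compl_backwardCluster S t
  have hzS : z ∉ S := fun h => hfc.up hz h hu
  have hruS : (z.1 + 1, z.2 + 1) ∈ S := by
    by_contra h
    exact hfc.left hru h (by simpa using hu)
  -- Both staircases lie outside the cluster and share their south-east arm. The cluster is trapped
  -- below `K₁` and above `K₂`: there is no room past the pinch, where the arms coincide, and only
  -- finite room on each diagonal.
  set K₁ := staircase S (z.1 + 1, z.2 + 1) (z.1 + 1, z.2)
  set K₂ := staircase S z (z.1 + 1, z.2)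
  have h₁ : ((z.1 + 1, z.2) : ℤ × ℤ) - (z.1 + 1, z.2 + 1) ∈ otspStepsSE := by
    simp [otspStepsSE]
  have h₂ : ((z.1 + 1, z.2) : ℤ × ℤ) - z ∈ otspStepsSE := by
    rw [sub_mem_otspStepsSE]
    simp
  have hu₁ : (z.1, z.2 + 1) ∉ upperClosure K₁ := by
    rw [mem_upperClosure]
    rintro ⟨_, ⟨k, rfl⟩ | ⟨k, rfl⟩, hle⟩
    · cases k with
      | zero =>
        have := hle.1
        simp at this
      | succ k =>
        have h1 := hle.2
        have h2 := (nwStep_iterate_le (S := S) (x := nwStep S (z.1 + 1, z.2 + 1)) k).2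
        rw [nwStep_of_mem hruS] at h2
        simp only [Function.iterate_succ_apply, nwStep_of_mem hruS] at h1 h2
        omega
    · have h1 := hle.1
      have h2 := (seStep_iterate_le (S := S) (x := (z.1 + 1, z.2)) k).1
      simp only at h1 h2
      omega
  have hu₂ : (z.1, z.2 + 1) ∉ lowerClosure K₂ := by
    rw [mem_lowerClosure]
    rintro ⟨_, ⟨k, rfl⟩ | ⟨k, rfl⟩, hle⟩
    · cases k with
      | zero =>
        have := hle.2
        simp at this
      | succ k =>
        have h1 := hle.1
        have h2 := (nwStep_iterate_le (S := S) (x := nwStep S z) k).1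
        rw [nwStep_of_notMem hzS] at h2
        simp only [Function.iterate_succ_apply, nwStep_of_notMem hzS] at h1
        omega
    · have h1 := hle.2
      have h2 := (seStep_iterate_le (S := S) (x := (z.1 + 1, z.2)) k).2
      simp only at h1 h2
      omega
  have hup : ∀ x ∈ B, x ∉ upperClosure K₁ := fun x hx => by
    have := fun y hy => mem_upperClosure_iff_of_mem_backwardCluster (x := y)
      (staircase_exists_nw h₁) (staircase_exists_se h₁) (hfc.staircase_subset hru hr) hy
    rwa [this x hx, ← this _ hu]
  have hlow : ∀ x ∈ B, x ∉ lowerClosure K₂ := fun x hx => by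
    have := fun y hy => mem_lowerClosure_iff_of_mem_backwardCluster (x := y)
      (staircase_exists_nw h₂) (staircase_exists_se h₂) (hfc.staircase_subset hz hr) hy
    rwa [this x hx, ← this _ hu]
  refine ⟨fun x hx => ?_, fun d => ?_⟩
  · by_contra! hlt
    set k := (x.1 - x.2 - (z.1 + 1 - z.2)).toNat
    have hcol := seStep_iterate_column (S := S) (x := (z.1 + 1, z.2)) k
    rcases le_total ((seStep S)^[k] (z.1 + 1, z.2)).1 x.1 with hle | hle
    · exact hup x hx (mem_upperClosure.2 ⟨_, Or.inr ⟨k, rfl⟩, hle, by simp only at hcol ⊢; omega⟩)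
    · exact hlow x hx (mem_lowerClosure.2 ⟨_, Or.inr ⟨k, rfl⟩, hle, by simp only at hcol ⊢; omega⟩)
  · obtain ⟨g₁, hg₁, hd₁⟩ := staircase_column (S := S) (a := (z.1 + 1, z.2 + 1))
      (b := (z.1 + 1, z.2)) (by simp only; omega) d
    obtain ⟨g₂, hg₂, hd₂⟩ := staircase_column (S := S) (a := z)
      (b := (z.1 + 1, z.2)) (by simp only; omega) d
    refine ((Set.finite_Icc g₂.1 g₁.1).image fun i => (i, i - d)).subset ?_
    rintro x ⟨hx, hxd⟩
    refine ⟨x.1, ⟨?_, ?_⟩, Prod.ext rfl (by simp only; omega)⟩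
    · by_contra! h
      exact hlow x hx (mem_lowerClosure.2 ⟨g₂, hg₂, h.le, by omega⟩)
    · by_contra! h
      exact hup x hx (mem_upperClosure.2 ⟨g₁, hg₁, h.le, by omega⟩)

/-- The sites outside the cluster with right or upper neighbour inside it are closed. Walking along
them with the cluster on the left, one turns down, diagonally or right; only a pinch could prevent
the move to the right. -/
lemma percolates_compl_of_no_pinch {S : Set (ℤ × ℤ)} {t : ℤ × ℤ}
    (hpinch : ∀ z, z ∉ backwardCluster (sitesEnv S) t →
      (z.1, z.2 + 1) ∈ backwardCluster (sitesEnv S) t →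
      (z.1 + 1, z.2) ∉ backwardCluster (sitesEnv S) t →
      (z.1 + 1, z.2 + 1) ∈ backwardCluster (sitesEnv S) t)
    {z : ℤ × ℤ} (hz : z ∉ backwardCluster (sitesEnv S) t)
    (hz' : (z.1 + 1, z.2) ∈ backwardCluster (sitesEnv S) t ∨
      (z.1, z.2 + 1) ∈ backwardCluster (sitesEnv S) t) :
    Percolates otspStepsSE Sᶜ z := by
  set B := backwardCluster (sitesEnv S) t
  have hfc : ForwardClosed S Bᶜ := forwardClosed_compl_backwardCluster S t
  let Z : Set (ℤ × ℤ) := {z | z ∉ B ∧ ((z.1 + 1, z.2) ∈ B ∨ (z.1, z.2 + 1) ∈ B)}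
  have hZ : Z ⊆ Sᶜ := by
    rintro z ⟨hz, h | h⟩ hS
    · exact hfc.right hz hS h
    · exact hfc.up hz hS h
  refine percolates_of_forall_exists_succ hZ (fun z hz => ?_) ⟨hz, hz'⟩
  have hdown : (z.1, z.2 - 1) ∉ B := hfc.down hz.1 (hZ hz)
  by_cases hr : (z.1 + 1, z.2) ∈ B
  · by_cases hrd : (z.1 + 1, z.2 - 1) ∈ B
    · exact ⟨(z.1, z.2 - 1), ⟨hdown, Or.inl hrd⟩, by simp [sub_mem_otspStepsSE]⟩
    · exact ⟨(z.1 + 1, z.2 - 1), ⟨hrd, Or.inr (by simpa using hr)⟩, by simp [sub_mem_otspStepsSE]⟩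
  · have hu : (z.1, z.2 + 1) ∈ B := hz.2.resolve_left hr
    exact ⟨(z.1 + 1, z.2), ⟨hr, Or.inr (hpinch z hz.1 hu hr)⟩, by simp [sub_mem_otspStepsSE]⟩

lemma backwardCluster_swap (S : Set (ℤ × ℤ)) (t : ℤ × ℤ) :
    backwardCluster (sitesEnv (Prod.swap ⁻¹' S)) t.swap =
      Prod.swap ⁻¹' backwardCluster (sitesEnv S) t := by
  have key : ∀ (S : Set (ℤ × ℤ)) (a b : ℤ × ℤ),
      b - a ∈ sitesEnv S a → b.swap - a.swap ∈ sitesEnv (Prod.swap ⁻¹' S) a.swap := by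
    intro S a b
    simp only [sub_mem_sitesEnv, mem_preimage, Prod.swap_swap, Prod.ext_iff, Prod.fst_swap,
      Prod.snd_swap]
    tauto
  ext x
  refine ⟨fun h => ?_, fun h => ?_⟩
  · have := Relation.ReflTransGen.lift (p := fun a b => b - a ∈ sitesEnv S a) Prod.swap
      (fun a b => key (Prod.swap ⁻¹' S) a b) _ _ h
    rw [Function.onFun, Prod.swap_swap] at this
    exact this
  · have := Relation.ReflTransGen.lift
      (p := fun a b => b - a ∈ sitesEnv (Prod.swap ⁻¹' S) a) Prod.swap (fun a b => key S a b) _ _ h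
    rwa [Function.onFun, Prod.swap_swap] at this

/-- If a backward cluster is infinite and its complement is not an upper set, then there is an
infinite oriented path of closed sites. -/
lemma exists_percolates_compl {S : Set (ℤ × ℤ)} {t : ℤ × ℤ}
    (hinf : (backwardCluster (sitesEnv S) t).Infinite)
    (hA : ¬ IsUpperSet (backwardCluster (sitesEnv S) t)ᶜ) :
    ∃ x, Percolates otspSteps Sᶜ x ∨ Percolates otspStepsSE Sᶜ x := by
  obtain ⟨z, hz, hz'⟩ : ∃ z, z ∉ backwardCluster (sitesEnv S) t ∧
      ((z.1 + 1, z.2) ∈ backwardCluster (sitesEnv S) t ∨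
        (z.1, z.2 + 1) ∈ backwardCluster (sitesEnv S) t) := by
    by_contra! h
    exact hA (isUpperSet_of_forall h)
  by_contra! hno
  have hSE : ¬ ∀ w, w ∉ backwardCluster (sitesEnv S) t →
      (w.1, w.2 + 1) ∈ backwardCluster (sitesEnv S) t →
      (w.1 + 1, w.2) ∉ backwardCluster (sitesEnv S) t →
      (w.1 + 1, w.2 + 1) ∈ backwardCluster (sitesEnv S) t := fun h =>
    (hno z).2 (percolates_compl_of_no_pinch h hz hz')
  -- Reflection in the diagonal preserves the environment rule and exchanges the two directions, so
  -- there is also a pinch bounding the cluster to the north-west.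
  have hNW : ¬ ∀ w, w ∉ backwardCluster (sitesEnv (Prod.swap ⁻¹' S)) t.swap →
      (w.1, w.2 + 1) ∈ backwardCluster (sitesEnv (Prod.swap ⁻¹' S)) t.swap →
      (w.1 + 1, w.2) ∉ backwardCluster (sitesEnv (Prod.swap ⁻¹' S)) t.swap →
      (w.1 + 1, w.2 + 1) ∈ backwardCluster (sitesEnv (Prod.swap ⁻¹' S)) t.swap := fun h => by
    have := percolates_compl_of_no_pinch h (z := z.swap) (by rwa [backwardCluster_swap])
      (by rw [backwardCluster_swap]; exact hz'.symm)
    rw [← preimage_compl, percolates_swap] at this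
    exact (hno z).1 this
  push Not at hSE hNW
  obtain ⟨w, h1, h2, h3, h4⟩ := hSE
  obtain ⟨w', h1', h2', h3', h4'⟩ := hNW
  obtain ⟨hub, hfin⟩ := backwardCluster_bounded_of_pinch h1 h2 h3 h4
  obtain ⟨hlb, -⟩ := backwardCluster_bounded_of_pinch h1' h2' h3' h4'
  refine hinf (((Set.finite_Icc (w'.2 - w'.1) (w.1 - w.2)).biUnion fun d _ => hfin d).subset ?_)
  intro x hx
  refine mem_biUnion (x := x.1 - x.2) ⟨?_, hub x hx⟩ ⟨hx, rfl⟩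
  have := hlb x.swap (by rwa [backwardCluster_swap, mem_preimage, Prod.swap_swap])
  simp only [Prod.fst_swap, Prod.snd_swap] at this
  omega

/-! ### Greedy paths separated by percolation paths -/

/-- Sites of the cluster may be dead ends, so walk back along predecessors. As `y.1 < x.1`, the walk
descends or reaches the column of `y` before it runs out at `x`. -/
lemma down_mem_upperClosure_siteCluster {S : Set (ℤ × ℤ)} {x y : ℤ × ℤ} (hyx : y.1 < x.1)
    (hy : y ∈ upperClosure (siteCluster otspSteps S x)) (hyS : y ∉ S) :
    (y.1, y.2 - 1) ∈ upperClosure (siteCluster otspSteps S x) := by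
  obtain ⟨g, hg, hgy⟩ := mem_upperClosure.1 hy
  obtain ⟨n, hn⟩ : ∃ n : ℕ, y.1 - g.1 = n :=
    ⟨_, (Int.toNat_of_nonneg (by have := hgy.1; omega)).symm⟩
  induction n generalizing g with
  | zero =>
    refine mem_upperClosure.2 ⟨g, hg, ?_⟩
    have : g.2 ≠ y.2 := fun h1 =>
      hyS ((Prod.ext (by omega) h1 : g = y) ▸ siteCluster_subset x hg)
    have := hgy.2
    exact Prod.mk_le_mk.2 ⟨by omega, by omega⟩
  | succ n ih =>
    obtain ⟨h1, h2⟩ := hgy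
    rcases hg.2.cases_tail with rfl | ⟨w, hxw, hwg⟩
    · omega
    · have hw : w ∈ siteCluster otspSteps S x := ⟨hg.1, hxw⟩
      rcases sub_mem_otspSteps.1 hwg.1 with rfl | rfl | rfl <;> push_cast at hn h1 h2
      · exact ih _ hw ⟨by omega, h2⟩ (by omega)
      · exact mem_upperClosure.2 ⟨_, hw, Prod.mk_le_mk.2 ⟨by omega, by omega⟩⟩
      · exact mem_upperClosure.2 ⟨_, hw, Prod.mk_le_mk.2 ⟨by omega, by omega⟩⟩

/-- Planarity of the triangular lattice: a path with sites in `T`, started below, cannot cross a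
path with sites in `S`. Diagonal steps are covered because entering the region above forces the site
below the entry point to be there too. -/
lemma siteCluster_disjoint_upperClosure {S T : Set (ℤ × ℤ)} (hST : Disjoint S T) {x y : ℤ × ℤ}
    (h₁ : y.1 < x.1) (h₂ : y.2 < x.2) {z : ℤ × ℤ} (hz : z ∈ siteCluster otspSteps T y) :
    z ∉ upperClosure (siteCluster otspSteps S x) := by
  obtain ⟨hy, hyz⟩ := hz
  induction hyz with
  | refl =>
    intro h
    obtain ⟨g, hg, hgy⟩ := mem_upperClosure.1 h
    have := (siteCluster_otspSteps_le hg).2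
    have := hgy.2
    omega
  | @tail b c hyb hbc ih =>
    intro h
    have hcy := (siteCluster_otspSteps_le (S := T) (x := y) ⟨hy, hyb.tail hbc⟩).1
    have := down_mem_upperClosure_siteCluster (hcy.trans_lt h₁) h
      fun hS => hST.le_bot ⟨hS, hbc.2⟩
    rcases sub_mem_otspSteps.1 hbc.1 with rfl | rfl | rfl
    · exact ih ((upperClosure _).upper (Prod.mk_le_mk.2 ⟨by omega, le_rfl⟩ : _ ≤ (b.1, b.2)) h)
    · exact ih (by simpa using this)
    · exact ih ((upperClosure _).upper
        (Prod.mk_le_mk.2 ⟨by omega, by omega⟩ : _ ≤ (b.1, b.2)) this)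

/-- An infinite open path starting at `x` and an infinite closed path starting below `x` keep
the greedy paths from their starting points apart. -/
lemma nwStep_iterate_ne_of_percolates {S T : Set (ℤ × ℤ)} (hST : Disjoint S T) {x y : ℤ × ℤ}
    (h₁ : y.1 < x.1) (h₂ : y.2 < x.2) (hx : Percolates otspSteps S x)
    (hy : Percolates otspSteps T y) (k : ℕ) : (nwStep S)^[k] x ≠ (nwStep S)^[k] y := by
  -- The greedy path from `x` goes left only at sites outside `S`, so it stays weakly above the open
  -- path; dually, the one from `y` goes up only at sites outside `T` and stays weakly below the
  -- other path.
  have hup : (nwStep S)^[k] x ∈ upperClosure (percolatingPart otspSteps S x) := by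
    induction k with
    | zero => exact subset_upperClosure ⟨hx.mem_siteCluster, hx⟩
    | succ k ih =>
      rw [Function.iterate_succ_apply']
      by_cases hS : (nwStep S)^[k] x ∈ S
      · rw [nwStep_of_mem hS]
        exact (upperClosure _).upper (Prod.mk_le_mk.2 ⟨le_rfl, by omega⟩) ih
      · rw [nwStep_of_notMem hS]
        exact left_mem_upperClosure (fun g => percolatingPart_exists_succ otspSteps_finite) ih
          fun h => hS h.2.mem
  have hlow : (nwStep S)^[k] y ∈ lowerClosure (percolatingPart otspSteps T y) := by
    clear hup
    induction k with
    | zero => exact subset_lowerClosure ⟨hy.mem_siteCluster, hy⟩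
    | succ k ih =>
      rw [Function.iterate_succ_apply']
      by_cases hS : (nwStep S)^[k] y ∈ S
      · rw [nwStep_of_mem hS]
        exact up_mem_lowerClosure (fun g => percolatingPart_exists_succ otspSteps_finite) ih
          fun h => hST.le_bot ⟨hS, h.2.mem⟩
      · rw [nwStep_of_notMem hS]
        exact (lowerClosure _).lower (Prod.mk_le_mk.2 ⟨by omega, le_rfl⟩) ih
  intro heq
  obtain ⟨g, hg, hgw⟩ := mem_upperClosure.1 hup
  obtain ⟨g', hg', hwg'⟩ := mem_lowerClosure.1 hlow
  exact siteCluster_disjoint_upperClosure hST h₁ h₂ hg'.1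
    (mem_upperClosure.2 ⟨g, hg.1, hgw.trans (heq ▸ hwg')⟩)

/-! ### The law of the site variables -/

instance isProbabilityMeasure_cond_Icc :
    IsProbabilityMeasure (ProbabilityTheory.cond (volume : Measure ℝ) (Icc (0 : ℝ) 1)) :=
  cond_isProbabilityMeasure_of_finite (by simp) (by simp)

instance isProbabilityMeasure_uniformSiteLaw : IsProbabilityMeasure uniformSiteLaw := by
  unfold uniformSiteLaw
  infer_instance

lemma cond_Icc_eq_restrict : ProbabilityTheory.cond (volume : Measure ℝ) (Icc (0 : ℝ) 1) =
    volume.restrict (Icc (0 : ℝ) 1) := by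
  simp [ProbabilityTheory.cond]

lemma uniformSiteLaw_eval {s : Set ℝ} (hs : MeasurableSet s) (x : ℤ × ℤ) :
    uniformSiteLaw {u | u x ∈ s} = volume (s ∩ Icc (0 : ℝ) 1) := by
  rw [← Measure.restrict_apply hs, ← cond_Icc_eq_restrict]
  exact (measurePreserving_eval_infinitePi
    (fun _ : ℤ × ℤ => ProbabilityTheory.cond volume (Icc (0 : ℝ) 1)) x).measure_preimage
      hs.nullMeasurableSet

lemma uniformSiteLaw_lt {p : ℝ} (hp : p ≤ 1) (x : ℤ × ℤ) :
    uniformSiteLaw {u | u x < p} = ENNReal.ofReal p := by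
  have := uniformSiteLaw_eval (s := Iio p) measurableSet_Iio x
  rw [show Iio p ∩ Icc 0 1 = Ico 0 p by ext; simp; grind] at this
  simpa using this

lemma measurePreserving_one_sub :
    MeasurePreserving (fun (u : ℤ × ℤ → ℝ) x => 1 - u x) uniformSiteLaw uniformSiteLaw := by
  refine ⟨by fun_prop, ?_⟩
  rw [uniformSiteLaw, Measure.infinitePi_map_pi _ (f := fun _ (t : ℝ) => 1 - t) (by fun_prop)]
  congr 1
  ext1 x
  rw [cond_Icc_eq_restrict]
  have h := (Measure.measurePreserving_sub_left (volume : Measure ℝ) 1).restrict_preimage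
    (s := Icc (0 : ℝ) 1) measurableSet_Icc
  simpa using h.map_eq

lemma measurePreserving_comp {e : ℤ × ℤ → ℤ × ℤ} (he : Function.Injective e) :
    MeasurePreserving (fun (u : ℤ × ℤ → ℝ) x => u (e x)) uniformSiteLaw uniformSiteLaw :=
  ⟨by fun_prop, Measure.map_infinitePi_infinitePi_of_inj he⟩

/-- The σ-algebra generated by the site variables in `T`. -/
abbrev siteAlgebra (T : Set (ℤ × ℤ)) : MeasurableSpace (ℤ × ℤ → ℝ) :=
  ⨆ x ∈ T, MeasurableSpace.comap (fun u => u x) inferInstance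

lemma iIndep_comap_eval : iIndep (fun x : ℤ × ℤ =>
    MeasurableSpace.comap (fun u : ℤ × ℤ → ℝ => u x) inferInstance) uniformSiteLaw :=
  (iIndepFun_iff_iIndep ..).1 (iIndepFun_infinitePi (X := fun _ (t : ℝ) => t) fun _ => measurable_id)

lemma comap_eval_le (x : ℤ × ℤ) :
    MeasurableSpace.comap (fun u : ℤ × ℤ → ℝ => u x) inferInstance ≤ MeasurableSpace.pi :=
  (measurable_pi_apply x).comap_le

-- Overwriting the coordinates outside `T` by `0` is measurable for the variables in `T`, and by
-- locality `E` is its own preimage under this map.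
open Classical in
lemma measurableSet_siteAlgebra {T : Set (ℤ × ℤ)} {E : Set (ℤ × ℤ → ℝ)} (hE : MeasurableSet E)
    (hT : DependsOn (· ∈ E) T) : MeasurableSet[siteAlgebra T] E := by
  have hm : Measurable[siteAlgebra T] fun u : ℤ × ℤ → ℝ => T.piecewise u 0 := by
    refine @measurable_pi_lambda _ _ _ (siteAlgebra T) _ _ fun x => ?_
    by_cases hx : x ∈ T
    · simp only [piecewise_eq_of_mem _ _ _ hx]
      exact Measurable.mono (comap_measurable fun u : ℤ × ℤ → ℝ => u x)
        (le_iSup₂_of_le x hx le_rfl) le_rfl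
    · simp only [piecewise_eq_of_notMem _ _ _ hx]
      exact measurable_const
  convert hm hE using 1
  ext u
  exact (hT fun x hx => (piecewise_eq_of_mem _ _ _ hx).symm).to_iff

lemma uniformSiteLaw_inter {T T' : Set (ℤ × ℤ)} (hTT : Disjoint T T') {E F : Set (ℤ × ℤ → ℝ)}
    (hE : MeasurableSet E) (hF : MeasurableSet F) (hET : DependsOn (· ∈ E) T)
    (hFT : DependsOn (· ∈ F) T') :
    uniformSiteLaw (E ∩ F) = uniformSiteLaw E * uniformSiteLaw F :=
  (Indep_iff _ _ _).1 (indep_iSup_of_disjoint comap_eval_le iIndep_comap_eval hTT) E F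
    (measurableSet_siteAlgebra hE hET) (measurableSet_siteAlgebra hF hFT)

/-- Kolmogorov's zero-one law for the site variables. -/
lemma uniformSiteLaw_zero_or_one {E : Set (ℤ × ℤ → ℝ)} (hE : MeasurableSet E)
    (h : ∀ F : Finset (ℤ × ℤ), DependsOn (· ∈ E) (F : Set (ℤ × ℤ))ᶜ) :
    uniformSiteLaw E = 0 ∨ uniformSiteLaw E = 1 := by
  refine measure_zero_or_one_of_measurableSet_limsup (f := Filter.cofinite) (p := Set.Finite)
    (ns := fun F : Finset (ℤ × ℤ) => (F : Set (ℤ × ℤ))) comap_eval_le iIndep_comap_eval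
    (fun t ht => ht.compl_mem_cofinite) (directed_of_isDirected_le fun _ _ h => h)
    (fun F => F.finite_toSet) (fun x => ⟨{x}, by simp⟩) ?_
  rw [Filter.limsup_eq_iInf_iSup, MeasurableSpace.measurableSet_iInf]
  intro T
  rw [MeasurableSpace.measurableSet_iInf]
  intro hT
  have hT' : Tᶜ.Finite := hT
  have := measurableSet_siteAlgebra hE (h hT'.toFinset)
  rwa [hT'.coe_toFinset, compl_compl] at this

/-! ### Measurability -/

section Measurability

variable {α β : Type*} [MeasurableSpace α] [Countable β]

lemma measurableSet_reflTransGen {R : α → β → β → Prop}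
    (hR : ∀ x y, MeasurableSet {a | R a x y}) (x y : β) :
    MeasurableSet {a | Relation.ReflTransGen (R a) x y} := by
  let E : ℕ → β → Set α := fun n => Nat.rec (fun y => {_a | x = y})
    (fun _ E y => ⋃ z, E z ∩ {a | R a z y}) n
  have hE : ∀ n y, MeasurableSet (E n y) := by
    intro n
    induction n with
    | zero => exact fun y => MeasurableSet.const _
    | succ n ih => exact fun y => MeasurableSet.iUnion fun z => (ih z).inter (hR z y)
  convert MeasurableSet.iUnion fun n => hE n y
  ext a
  simp only [mem_ofPred_eq, mem_iUnion]
  constructor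
  · intro h
    induction h with
    | refl => exact ⟨0, rfl⟩
    | tail _ hstep ih =>
      obtain ⟨n, hn⟩ := ih
      exact ⟨n + 1, mem_iUnion.2 ⟨_, hn, hstep⟩⟩
  · rintro ⟨n, hn⟩
    induction n generalizing y with
    | zero => exact (show x = y from hn) ▸ .refl
    | succ n ih =>
      obtain ⟨z, hz, hzy⟩ := mem_iUnion.1 hn
      exact (ih z hz).tail hzy

lemma measurableSet_infinite {C : α → Set β} (hC : ∀ y, MeasurableSet {a | y ∈ C a}) :
    MeasurableSet {a | (C a).Infinite} := by
  have : {a | (C a).Infinite} = ⋂ F : Finset β, ⋃ y, ⋃ _ : y ∉ F, {a | y ∈ C a} := by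
    ext a
    simp only [mem_ofPred_eq, mem_iInter, mem_iUnion, exists_prop]
    refine ⟨fun h F => ?_, fun h hfin => ?_⟩
    · obtain ⟨y, hy, hyF⟩ := h.exists_notMem_finset F
      exact ⟨y, hyF, hy⟩
    · obtain ⟨y, hyF, hy⟩ := h hfin.toFinset
      exact hyF (by simpa)
  rw [this]
  exact .iInter fun F => .iUnion fun y => .iUnion fun _ => hC y

variable {S : α → Set (ℤ × ℤ)} (hS : ∀ x, MeasurableSet {a | x ∈ S a})
include hS

lemma measurableSet_percolates (D : Set (ℤ × ℤ)) (x : ℤ × ℤ) :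
    MeasurableSet {a | Percolates D (S a) x} :=
  measurableSet_infinite fun y => (hS x).inter
    (measurableSet_reflTransGen (fun _ z => (MeasurableSet.const _).inter (hS z)) x y)

lemma measurableSet_mem_backwardCluster (t x : ℤ × ℤ) :
    MeasurableSet {a | x ∈ backwardCluster (sitesEnv (S a)) t} := by
  refine measurableSet_reflTransGen (fun x y => ?_) x t
  simp only [sub_mem_sitesEnv]
  exact ((hS x).inter (.const _)).union ((hS x).compl.inter (.const _))

lemma measurableSet_mem_outerBoundary (t x : ℤ × ℤ) :
    MeasurableSet {a | x ∈ outerBoundary (backwardCluster (sitesEnv (S a)) t)} :=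
  (measurableSet_mem_backwardCluster hS t x).compl.inter
    ((measurableSet_mem_backwardCluster hS t _).union (measurableSet_mem_backwardCluster hS t _))

lemma measurableSet_nwStep_iterate_eq (k : ℕ) (x y : ℤ × ℤ) :
    MeasurableSet {a | (nwStep (S a))^[k] x = y} := by
  induction k generalizing x with
  | zero => exact MeasurableSet.const (x = y)
  | succ k ih =>
    have : {a | (nwStep (S a))^[k + 1] x = y} =
        ({a | x ∈ S a} ∩ {a | (nwStep (S a))^[k] (x.1, x.2 + 1) = y}) ∪
          ({a | x ∈ S a}ᶜ ∩ {a | (nwStep (S a))^[k] (x.1 - 1, x.2) = y}) := by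
      ext a
      by_cases h : x ∈ S a <;>
        simp [h, nwStep_of_mem, nwStep_of_notMem]
    rw [this]
    exact ((hS x).inter (ih _)).union ((hS x).compl.inter (ih _))

lemma measurableSet_nwStep_iterate_ne (x y : ℤ × ℤ) :
    MeasurableSet {a | ∀ k, (nwStep (S a))^[k] x ≠ (nwStep (S a))^[k] y} := by
  have : {a | ∀ k, (nwStep (S a))^[k] x ≠ (nwStep (S a))^[k] y} =
      ⋂ k, (⋃ z, {a | (nwStep (S a))^[k] x = z} ∩ {a | (nwStep (S a))^[k] y = z})ᶜ := by
    ext a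
    simp [eq_comm]
  rw [this]
  exact .iInter fun k => (MeasurableSet.iUnion fun z =>
    (measurableSet_nwStep_iterate_eq hS k x z).inter
      (measurableSet_nwStep_iterate_eq hS k y z)).compl

end Measurability

lemma measurableSet_eval_lt (p : ℝ) (x : ℤ × ℤ) :
    MeasurableSet {u : ℤ × ℤ → ℝ | x ∈ {z | u z < p}} :=
  measurableSet_lt (measurable_pi_apply x) measurable_const

/-! ### Locality of percolation events -/

lemma siteCluster_congr {D S T : Set (ℤ × ℤ)} {x : ℤ × ℤ} (h : siteCluster D S x ⊆ T) :
    siteCluster D S x ⊆ siteCluster D T x := by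
  rintro y ⟨hx, hxy⟩
  induction hxy with
  | refl => exact ⟨h ⟨hx, .refl⟩, .refl⟩
  | tail hxb hbc ih => exact ⟨ih.1, ih.2.tail ⟨hbc.1, h ⟨hx, hxb.tail hbc⟩⟩⟩

lemma percolates_congr_nw {S T : Set (ℤ × ℤ)} {x : ℤ × ℤ}
    (h : ∀ y : ℤ × ℤ, y.1 ≤ x.1 → x.2 ≤ y.2 → (y ∈ S ↔ y ∈ T)) :
    Percolates otspSteps S x ↔ Percolates otspSteps T x := by
  constructor <;> refine fun hp => Set.Infinite.mono (siteCluster_congr fun y hy => ?_) hp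
  · exact (h y (siteCluster_otspSteps_le hy).1 (siteCluster_otspSteps_le hy).2).1
      (siteCluster_subset x hy)
  · exact (h y (siteCluster_otspSteps_le hy).1 (siteCluster_otspSteps_le hy).2).2
      (siteCluster_subset x hy)

lemma percolates_congr_se {S T : Set (ℤ × ℤ)} {x : ℤ × ℤ}
    (h : ∀ y : ℤ × ℤ, x.1 ≤ y.1 → y.2 ≤ x.2 → (y ∈ S ↔ y ∈ T)) :
    Percolates otspStepsSE S x ↔ Percolates otspStepsSE T x := by
  constructor <;> refine fun hp => Set.Infinite.mono (siteCluster_congr fun y hy => ?_) hp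
  · exact (h y (siteCluster_otspStepsSE_le hy).1 (siteCluster_otspStepsSE_le hy).2).1
      (siteCluster_subset x hy)
  · exact (h y (siteCluster_otspStepsSE_le hy).1 (siteCluster_otspStepsSE_le hy).2).2
      (siteCluster_subset x hy)

lemma measurableSet_percolates_eval {s : Set ℝ} (hs : MeasurableSet s) (D : Set (ℤ × ℤ))
    (x : ℤ × ℤ) : MeasurableSet {u : ℤ × ℤ → ℝ | Percolates D {z | u z ∈ s} x} :=
  measurableSet_percolates (fun z => measurable_pi_apply z hs) D x

lemma uniformSiteLaw_percolates_add {D : Set (ℤ × ℤ)} (s : Set ℝ) (hs : MeasurableSet s)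
    (x : ℤ × ℤ) : uniformSiteLaw {u | Percolates D {z | u z ∈ s} x} =
      uniformSiteLaw {u | Percolates D {z | u z ∈ s} (0, 0)} := by
  rw [← (measurePreserving_comp (add_left_injective x)).measure_preimage
    (measurableSet_percolates_eval hs D (0, 0)).nullMeasurableSet]
  congr 1
  ext u
  simpa [Prod.mk_zero_zero] using (percolates_add (D := D) {z | u z ∈ s} x 0).symm

lemma uniformSiteLaw_percolates_swap (s : Set ℝ) (hs : MeasurableSet s) :
    uniformSiteLaw {u | Percolates otspStepsSE {z | u z ∈ s} (0, 0)} =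
      uniformSiteLaw {u | Percolates otspSteps {z | u z ∈ s} (0, 0)} := by
  rw [← (measurePreserving_comp Prod.swap_injective).measure_preimage
    (measurableSet_percolates_eval hs otspStepsSE (0, 0)).nullMeasurableSet]
  congr 1
  ext u
  exact percolates_swap {z | u z ∈ s} (0, 0)

/-! ### Bi-infinite open paths exist in the percolating phase -/

/-- The event that `x` lies on a bi-infinite open path. -/
def biPercolates (p : ℝ) (x : ℤ × ℤ) : Set (ℤ × ℤ → ℝ) :=
  {u | Percolates otspSteps {z | u z < p} x ∧ Percolates otspStepsSE {z | u z < p} x}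

lemma measurableSet_biPercolates (p : ℝ) (x : ℤ × ℤ) : MeasurableSet (biPercolates p x) :=
  (measurableSet_percolates (measurableSet_eval_lt p) _ x).inter
    (measurableSet_percolates (measurableSet_eval_lt p) _ x)

lemma uniformSiteLaw_biPercolates (p : ℝ) (x : ℤ × ℤ) :
    uniformSiteLaw (biPercolates p x) = uniformSiteLaw (biPercolates p (0, 0)) := by
  rw [← (measurePreserving_comp (add_left_injective x)).measure_preimage
    (measurableSet_biPercolates p (0, 0)).nullMeasurableSet]
  congr 1
  ext u
  have h₁ := percolates_add (D := otspSteps) {z | u z < p} x 0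
  have h₂ := percolates_add (D := otspStepsSE) {z | u z < p} x 0
  rw [zero_add] at h₁ h₂
  exact (and_congr h₁ h₂).symm

/-- Apart from the state of the origin, the two arms depend on the disjoint half-planes on either
side of the diagonal. The three events are independent, and each has positive probability. -/
lemma uniformSiteLaw_biPercolates_pos {p : ℝ}
    (hp : 0 < uniformSiteLaw {u | Percolates otspSteps {z | u z < p} (0, 0)}) :
    0 < uniformSiteLaw (biPercolates p (0, 0)) := by
  have hp' := uniformSiteLaw_percolates_swap (Iio p) measurableSet_Iio
  simp only [mem_Iio] at hp'
  let A : Set (ℤ × ℤ → ℝ) := {u | u (0, 0) < p}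
  let F : Set (ℤ × ℤ) → Set (ℤ × ℤ → ℝ) := fun D =>
    {u | ∃ y : ℤ × ℤ, y - (0, 0) ∈ D ∧ Percolates D {z | u z < p} y}
  have hA : MeasurableSet A := measurableSet_eval_lt p (0, 0)
  have hF : ∀ D, MeasurableSet (F D) := fun D => by
    have : F D = ⋃ y, {_u | y - (0, 0) ∈ D} ∩ {u | Percolates D {z | u z < p} y} := by
      ext u
      simp [F]
    rw [this]
    exact .iUnion fun y =>
      (MeasurableSet.const _).inter (measurableSet_percolates (measurableSet_eval_lt p) _ y)
  have heq : biPercolates p (0, 0) = A ∩ (F otspSteps ∩ F otspStepsSE) := by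
    ext u
    change Percolates _ _ _ ∧ Percolates _ _ _ ↔ _
    rw [percolates_iff_exists_succ otspSteps_finite, percolates_iff_exists_succ otspStepsSE_finite]
    simp only [A, F, mem_inter_iff, mem_ofPred_eq]
    tauto
  have hNW : DependsOn (· ∈ F otspSteps) {z : ℤ × ℤ | z.1 - z.2 < 0} := fun u v huv => by
    refine propext (exists_congr fun y => and_congr_right fun hy => percolates_congr_nw ?_)
    intro z hz1 hz2
    have : z.1 - z.2 < 0 := by
      rcases sub_mem_otspSteps.1 hy with rfl | rfl | rfl <;> simp only at hz1 hz2 <;> omega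
    simp only [mem_ofPred_eq, huv z this]
  have hSE : DependsOn (· ∈ F otspStepsSE) {z : ℤ × ℤ | 0 < z.1 - z.2} := fun u v huv => by
    refine propext (exists_congr fun y => and_congr_right fun hy => percolates_congr_se ?_)
    intro z hz1 hz2
    have : 0 < z.1 - z.2 := by
      rcases sub_mem_otspStepsSE.1 hy with rfl | rfl | rfl <;> simp only at hz1 hz2 <;> omega
    simp only [mem_ofPred_eq, huv z this]
  have hA' : DependsOn (· ∈ A) {(0, 0)} := fun u v huv => by
    simp only [A, mem_ofPred_eq, huv _ rfl]
  have hboth : DependsOn (· ∈ F otspSteps ∩ F otspStepsSE) {z : ℤ × ℤ | z.1 - z.2 ≠ 0} :=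
    fun u v huv => propext (and_congr
      (hNW fun x hx => huv x (ne_of_lt hx)).to_iff (hSE fun x hx => huv x (ne_of_gt hx)).to_iff)
  rw [heq, uniformSiteLaw_inter (T := {(0, 0)}) (T' := {z : ℤ × ℤ | z.1 - z.2 ≠ 0}) (by simp)
    hA ((hF _).inter (hF _)) hA' hboth,
    uniformSiteLaw_inter (T := {z : ℤ × ℤ | z.1 - z.2 < 0}) (T' := {z : ℤ × ℤ | 0 < z.1 - z.2})
      (Set.disjoint_left.2 fun z hz => by
        simp only [mem_ofPred_eq] at hz ⊢
        omega) (hF _) (hF _) hNW hSE]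
  refine ENNReal.mul_pos ?_ (mul_ne_zero ?_ ?_)
  · exact (hp.trans_le (measure_mono fun u hu => Percolates.mem hu)).ne'
  · exact (hp.trans_le (measure_mono fun u hu =>
      ((percolates_iff_exists_succ otspSteps_finite).1 hu).2)).ne'
  · exact ((hp.trans_eq hp'.symm).trans_le (measure_mono fun u hu =>
      ((percolates_iff_exists_succ otspStepsSE_finite).1 hu).2)).ne'

/-- In the percolating phase there is almost surely a bi-infinite open path through the positive
part of the diagonal. -/
lemma ae_exists_biPercolates {p : ℝ}
    (hp : 0 < uniformSiteLaw {u | Percolates otspSteps {z | u z < p} (0, 0)}) :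
    ∀ᵐ u ∂uniformSiteLaw, ∃ n : ℤ, 0 < n ∧ u ∈ biPercolates p (n, n) := by
  let E : ℕ → Set (ℤ × ℤ → ℝ) := fun n => biPercolates p (n, n)
  let G : ℕ → Set (ℤ × ℤ → ℝ) := fun N => ⋃ n, ⋃ _ : N ≤ n, E n
  have hGm : ∀ N, MeasurableSet (G N) := fun N =>
    .iUnion fun n => .iUnion fun _ => measurableSet_biPercolates p _
  have hG : Antitone G := fun N M hNM => iUnion_mono fun n => iUnion_subset fun hn =>
    subset_iUnion_of_subset (hNM.trans hn) le_rfl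
  have hpos := uniformSiteLaw_biPercolates_pos hp
  have hlim := tendsto_measure_iInter_atTop (μ := uniformSiteLaw)
    (fun N => (hGm N).nullMeasurableSet) hG ⟨0, measure_ne_top _ _⟩
  have hge : uniformSiteLaw (biPercolates p (0, 0)) ≤ uniformSiteLaw (⋂ N, G N) :=
    ge_of_tendsto' hlim fun N => by
      rw [← uniformSiteLaw_biPercolates p (N, N)]
      exact measure_mono (subset_iUnion₂_of_subset N le_rfl le_rfl)
  have hdep : ∀ F : Finset (ℤ × ℤ), DependsOn (· ∈ ⋂ N, G N) (F : Set (ℤ × ℤ))ᶜ := by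
    intro F
    have key : ∀ u v : ℤ × ℤ → ℝ, (∀ x ∈ (F : Set (ℤ × ℤ))ᶜ, u x = v x) →
        u ∈ ⋂ N, G N → v ∈ ⋂ N, G N := by
      intro u v huv hu
      obtain ⟨c, hc⟩ := (F.finite_toSet.image fun x : ℤ × ℤ => max x.1 x.2).bddAbove
      simp only [mem_iInter, G, mem_iUnion] at hu ⊢
      intro N
      -- The arms from `(n, n)` use only sites with some coordinate at least `n`, so `n > c` keeps
      -- them away from `F`: the event is a tail event.
      obtain ⟨n, hn, hun⟩ := hu (max N (c.toNat + 1))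
      have hout : ∀ z : ℤ × ℤ, (n : ℤ) ≤ z.1 ∨ (n : ℤ) ≤ z.2 → z ∈ (F : Set (ℤ × ℤ))ᶜ := by
        intro z hz hzF
        have : max z.1 z.2 ≤ c := hc (mem_image_of_mem _ hzF)
        omega
      refine ⟨n, (le_max_left _ _).trans hn, ?_, ?_⟩
      · refine (percolates_congr_nw fun z _ hz2 => ?_).1 hun.1
        simp only [mem_ofPred_eq, huv z (hout z (Or.inr hz2))]
      · refine (percolates_congr_se fun z hz1 _ => ?_).1 hun.2
        simp only [mem_ofPred_eq, huv z (hout z (Or.inl hz1))]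
    exact fun u v huv => propext ⟨key u v huv, key v u fun x hx => (huv x hx).symm⟩
  rcases uniformSiteLaw_zero_or_one (.iInter hGm) hdep with h0 | h1
  · exact absurd (h0 ▸ hge) (not_le.2 hpos)
  · have : ∀ᵐ u ∂uniformSiteLaw, u ∈ ⋂ N, G N :=
      (mem_ae_iff_prob_eq_one (.iInter hGm)).2 h1
    filter_upwards [this] with u hu
    have := mem_iInter.1 hu 1
    simp only [G, mem_iUnion] at this
    obtain ⟨n, hn, hun⟩ := this
    exact ⟨n, by omega, hun⟩

/-! ### Coalescence of the greedy paths at density one half -/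

/-- A bounded convex sequence starting at zero is nonpositive. -/
lemma nonpos_of_bounded_convex {h : ℕ → ℝ} (h0 : h 0 = 0) (h1 : ∀ j, h j ≤ 1)
    (hc : ∀ j, 2 * h (j + 1) ≤ h (j + 2) + h j) (j : ℕ) : h j ≤ 0 := by
  have hnonpos : ∀ i, h (i + 1) ≤ h i := by
    intro i
    by_contra! hlt
    -- By convexity a positive increment persists, which forces linear growth past the bound.
    have hmono : ∀ n, h (i + 1) - h i ≤ h (i + n + 1) - h (i + n) := fun n => by
      induction n with
      | zero => simp
      | succ n ih =>
        have := hc (i + n)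
        rw [← add_assoc]
        linarith
    have hlin : ∀ n : ℕ, h i + n * (h (i + 1) - h i) ≤ h (i + n) := fun n => by
      induction n with
      | zero => simp
      | succ n ih =>
        have := hmono n
        rw [← add_assoc]
        push_cast
        linarith
    obtain ⟨n, hn⟩ := exists_nat_gt ((1 - h i) / (h (i + 1) - h i))
    rw [div_lt_iff₀ (by linarith)] at hn
    linarith [hlin n, h1 (i + n)]
  induction j with
  | zero => exact h0.le
  | succ j ih => exact (hnonpos j).trans ih

lemma nwStep_iterate_congr {S T : Set (ℤ × ℤ)} {x : ℤ × ℤ}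
    (h : ∀ z : ℤ × ℤ, z.1 - z.2 ≤ x.1 - x.2 → (z ∈ S ↔ z ∈ T)) (k : ℕ) :
    (nwStep S)^[k] x = (nwStep T)^[k] x := by
  induction k with
  | zero => rfl
  | succ k ih =>
    rw [Function.iterate_succ_apply', Function.iterate_succ_apply', ← ih]
    have hcol := nwStep_iterate_column (S := S) (x := x) k
    have := h ((nwStep S)^[k] x) (by omega)
    by_cases hS : (nwStep S)^[k] x ∈ S
    · rw [nwStep_of_mem hS, nwStep_of_mem (this.1 hS)]
    · rw [nwStep_of_notMem hS, nwStep_of_notMem fun h => hS (this.2 h)]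

/-- The event that the greedy north-west paths from `x` and `y` never meet, when sites are open
with probability one half. -/
def neverMeet (x y : ℤ × ℤ) : Set (ℤ × ℤ → ℝ) :=
  {u | ∀ k, (nwStep {z | u z < 1 / 2})^[k] x ≠ (nwStep {z | u z < 1 / 2})^[k] y}

lemma measurableSet_neverMeet (x y : ℤ × ℤ) : MeasurableSet (neverMeet x y) :=
  measurableSet_nwStep_iterate_ne (measurableSet_eval_lt (1 / 2)) x y

lemma dependsOn_neverMeet {x y : ℤ × ℤ} {c : ℤ} (hx : x.1 - x.2 ≤ c) (hy : y.1 - y.2 ≤ c) :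
    DependsOn (· ∈ neverMeet x y) {z : ℤ × ℤ | z.1 - z.2 ≤ c} := fun u v huv => by
  refine propext (forall_congr' fun k => not_congr ?_)
  rw [nwStep_iterate_congr (T := {z | v z < 1 / 2}) (x := x) (fun z hz => ?_),
    nwStep_iterate_congr (T := {z | v z < 1 / 2}) (x := y) (fun z hz => ?_)]
  · simp only [mem_ofPred_eq, huv z (hz.trans hy)]
  · simp only [mem_ofPred_eq, huv z (hz.trans hx)]

lemma uniformSiteLaw_lt_half_iff (x : ℤ × ℤ) (a : Prop) :
    uniformSiteLaw {u | u x < 1 / 2 ↔ a} = 2⁻¹ := by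
  have h := uniformSiteLaw_lt (p := 1 / 2) (by norm_num) x
  rw [one_div, ENNReal.ofReal_inv_of_pos two_pos, ENNReal.ofReal_ofNat, ← one_div] at h
  by_cases ha : a
  · simpa [ha] using h
  · have := prob_compl_eq_one_sub (μ := uniformSiteLaw) (measurableSet_eval_lt (1 / 2) x)
    simp only [mem_ofPred_eq, h, ENNReal.one_sub_inv_two, compl_ofPred] at this
    simpa [ha] using this

/-- The two first steps read distinct sites of one diagonal, and the later paths read only further
diagonals, so the three events are independent. -/
lemma uniformSiteLaw_half_half_inter {x y : ℤ × ℤ} (hxy : x ≠ y) (hcol : x.1 - x.2 = y.1 - y.2)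
    (a b : Prop) {x' y' : ℤ × ℤ} (hx' : x'.1 - x'.2 = x.1 - x.2 - 1)
    (hy' : y'.1 - y'.2 = x.1 - x.2 - 1) :
    uniformSiteLaw.real ({u | u x < 1 / 2 ↔ a} ∩ ({u | u y < 1 / 2 ↔ b} ∩ neverMeet x' y')) =
      1 / 4 * uniformSiteLaw.real (neverMeet x' y') := by
  have hm : ∀ (z : ℤ × ℤ) (c : Prop), MeasurableSet {u : ℤ × ℤ → ℝ | u z < 1 / 2 ↔ c} :=
    fun z c => (measurableSet_eval_lt (1 / 2) z).iff (.const c)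
  have hd : ∀ (z : ℤ × ℤ) (c : Prop),
      DependsOn (· ∈ {u : ℤ × ℤ → ℝ | u z < 1 / 2 ↔ c}) {z} := fun z c u v huv => by
    simp only [mem_ofPred_eq, huv z rfl]
  have hM := dependsOn_neverMeet hx'.le hy'.le
  have hyM : DependsOn (· ∈ {u : ℤ × ℤ → ℝ | u y < 1 / 2 ↔ b} ∩ neverMeet x' y')
      ({y} ∪ {z : ℤ × ℤ | z.1 - z.2 ≤ x.1 - x.2 - 1}) := fun u v huv =>
    propext (and_congr (hd y b fun z hz => huv z (Or.inl hz)).to_iff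
      (hM fun z hz => huv z (Or.inr hz)).to_iff)
  rw [Measure.real, uniformSiteLaw_inter (T := {x})
      (T' := {y} ∪ {z : ℤ × ℤ | z.1 - z.2 ≤ x.1 - x.2 - 1}) ?_ (hm x a)
      ((hm y b).inter (measurableSet_neverMeet _ _)) (hd x a) hyM,
    uniformSiteLaw_inter (T := {y}) (T' := {z : ℤ × ℤ | z.1 - z.2 ≤ x.1 - x.2 - 1}) ?_
      (hm y b) (measurableSet_neverMeet _ _) (hd y b) hM,
    uniformSiteLaw_lt_half_iff, uniformSiteLaw_lt_half_iff, ← mul_assoc, ENNReal.toReal_mul,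
    Measure.real]
  · norm_num
  · simp only [disjoint_singleton_left, mem_ofPred_eq]
    omega
  · refine disjoint_singleton_left.2 (not_or_intro hxy ?_)
    simp only [mem_ofPred_eq]
    omega

lemma neverMeet_subset (x y : ℤ × ℤ) : neverMeet x y ⊆
    (({u | u x < 1 / 2 ↔ True} ∩ ({u | u y < 1 / 2 ↔ True} ∩
        neverMeet (x.1, x.2 + 1) (y.1, y.2 + 1))) ∪
      ({u | u x < 1 / 2 ↔ True} ∩ ({u | u y < 1 / 2 ↔ False} ∩
        neverMeet (x.1, x.2 + 1) (y.1 - 1, y.2)))) ∪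
    (({u | u x < 1 / 2 ↔ False} ∩ ({u | u y < 1 / 2 ↔ True} ∩
        neverMeet (x.1 - 1, x.2) (y.1, y.2 + 1))) ∪
      ({u | u x < 1 / 2 ↔ False} ∩ ({u | u y < 1 / 2 ↔ False} ∩
        neverMeet (x.1 - 1, x.2) (y.1 - 1, y.2)))) := by
  intro u hu
  have key : u ∈ neverMeet (nwStep {z | u z < 1 / 2} x) (nwStep {z | u z < 1 / 2} y) :=
    fun k => by
      have := hu (k + 1)
      rwa [Function.iterate_succ_apply, Function.iterate_succ_apply] at this
  by_cases hx : u x < 1 / 2 <;> by_cases hy : u y < 1 / 2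
  · rw [nwStep_of_mem hx, nwStep_of_mem hy] at key
    exact Or.inl (Or.inl ⟨by simpa using hx, by simpa using hy, key⟩)
  · rw [nwStep_of_mem hx, nwStep_of_notMem hy] at key
    exact Or.inl (Or.inr ⟨by simpa using hx, by simpa using hy, key⟩)
  · rw [nwStep_of_notMem hx, nwStep_of_mem hy] at key
    exact Or.inr (Or.inl ⟨by simpa using hx, by simpa using hy, key⟩)
  · rw [nwStep_of_notMem hx, nwStep_of_notMem hy] at key
    exact Or.inr (Or.inr ⟨by simpa using hx, by simpa using hy, key⟩)

/-- The greedy north-west paths from two sites on the same diagonal almost surely meet. -/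
lemma uniformSiteLaw_neverMeet (x : ℤ × ℤ) (j : ℕ) :
    uniformSiteLaw (neverMeet (x.1 + j, x.2 + j) x) = 0 := by
  let f : ℕ → ℤ × ℤ → ℝ := fun j x => uniformSiteLaw.real (neverMeet (x.1 + j, x.2 + j) x)
  -- The supremum over base points makes translation invariance unnecessary.
  let h : ℕ → ℝ := fun j => ⨆ x, f j x
  have hbdd : ∀ j, BddAbove (range (f j)) := fun j =>
    ⟨1, by rintro _ ⟨x, rfl⟩; exact measureReal_le_one⟩
  have hfh : ∀ j x, f j x ≤ h j := fun j x => le_ciSup (hbdd j) x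
  have h0 : h 0 = 0 := by
    have : ∀ x, f 0 x = 0 := fun x => by
      have : neverMeet x x = ∅ := eq_empty_of_forall_notMem fun u hu => hu 0 rfl
      simp [f, this]
    simp [h, this]
  have hstep : ∀ j, 2 * h (j + 1) ≤ h (j + 2) + h j := by
    intro j
    -- The separation is unchanged if both paths make the same move; otherwise it changes by one, up
    -- or down with equal probability.
    have : h (j + 1) ≤ 1 / 4 * h (j + 1) + 1 / 4 * h (j + 2) + (1 / 4 * h j + 1 / 4 * h (j + 1)) := by
      refine ciSup_le fun x => ?_
      set y : ℤ × ℤ := (x.1 + (j + 1 : ℕ), x.2 + (j + 1 : ℕ)) with hy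
      have hyx : y ≠ x := fun h => by
        have := congrArg Prod.fst h
        simp only [hy] at this
        omega
      have hcol : y.1 - y.2 = x.1 - x.2 := by simp [hy]
      have h1 := hfh (j + 1) (x.1, x.2 + 1)
      have h2 := hfh (j + 2) (x.1 - 1, x.2)
      have h3 := hfh j (x.1, x.2 + 1)
      have h4 := hfh (j + 1) (x.1 - 1, x.2)
      have e1 : ((x.1 + (j + 1 : ℕ), x.2 + 1 + (j + 1 : ℕ)) : ℤ × ℤ) = (y.1, y.2 + 1) := by
        refine Prod.ext (by simp only [hy]) ?_
        simp only [hy]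
        push_cast
        ring
      have e2 : ((x.1 - 1 + (j + 2 : ℕ), x.2 + (j + 2 : ℕ)) : ℤ × ℤ) = (y.1, y.2 + 1) := by
        refine Prod.ext ?_ ?_ <;> simp only [hy] <;> push_cast <;> ring
      have e3 : ((x.1 + (j : ℕ), x.2 + 1 + (j : ℕ)) : ℤ × ℤ) = (y.1 - 1, y.2) := by
        refine Prod.ext ?_ ?_ <;> simp only [hy] <;> push_cast <;> ring
      have e4 : ((x.1 - 1 + (j + 1 : ℕ), x.2 + (j + 1 : ℕ)) : ℤ × ℤ) = (y.1 - 1, y.2) :=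
        Prod.ext (by simp only [hy]; ring) (by simp only [hy])
      simp only [f, e1, e2, e3, e4] at h1 h2 h3 h4
      refine (measureReal_mono (neverMeet_subset y x)).trans ((measureReal_union_le _ _).trans
        (add_le_add ((measureReal_union_le _ _).trans ?_) ((measureReal_union_le _ _).trans ?_))) <;>
      rw [uniformSiteLaw_half_half_inter hyx hcol _ _ (by simp only; omega) (by simp only; omega),
        uniformSiteLaw_half_half_inter hyx hcol _ _ (by simp only; omega) (by simp only; omega)] <;>
      linarith
    linarith
  have := (hfh j x).trans (nonpos_of_bounded_convex h0
    (fun j => ciSup_le fun x => measureReal_le_one) hstep j)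
  exact (measureReal_eq_zero_iff).1 (le_antisymm this measureReal_nonneg)

/-! ### No percolation at density one half -/

/-- The law is invariant under `u ↦ 1 - u` and under the reflection `ρ : (a, b) ↦ (-b, -a)`, which
preserves `otspSteps` and sends `(m, m)` to `(-m, -m)`. -/
lemma ae_exists_percolates_gt_half
    (hp : 0 < uniformSiteLaw {u | Percolates otspSteps {z | u z < 1 / 2} (0, 0)}) :
    ∀ᵐ u ∂uniformSiteLaw, ∃ m : ℤ, 0 < m ∧ Percolates otspSteps {z | 1 / 2 < u z} (-m, -m) := by
  let ρ : ℤ × ℤ ≃ ℤ × ℤ := (Equiv.prodComm ℤ ℤ).trans (Equiv.neg _)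
  have hρ : ∀ a b, ρ b - ρ a ∈ otspSteps ↔ b - a ∈ otspSteps := fun a b => by
    simp only [sub_mem_otspSteps, ρ, Equiv.trans_apply, Equiv.prodComm_apply, Equiv.neg_apply,
      Prod.ext_iff, Prod.fst_neg, Prod.snd_neg, Prod.fst_swap, Prod.snd_swap]
    omega
  have hmp := measurePreserving_one_sub.comp (measurePreserving_comp ρ.injective)
  filter_upwards [hmp.quasiMeasurePreserving.ae (ae_exists_biPercolates hp)] with u hu
  obtain ⟨m, hm, hu, -⟩ := hu
  refine ⟨m, hm, ?_⟩
  have h := percolates_equiv ρ hρ {z | 1 / 2 < u z} (m, m)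
  refine h.1 (hu.mono fun z hz => ?_)
  simp only [Function.comp_apply, mem_ofPred_eq, mem_preimage] at hz ⊢
  linarith

lemma uniformSiteLaw_percolates_half :
    uniformSiteLaw {u | Percolates otspSteps {z | u z < 1 / 2} (0, 0)} = 0 := by
  by_contra h
  have hp := pos_iff_ne_zero.2 h
  have hmeet : ∀ᵐ u ∂uniformSiteLaw, ∀ (x : ℤ × ℤ) (j : ℕ),
      u ∉ neverMeet (x.1 + j, x.2 + j) x :=
    ae_all_iff.2 fun x => ae_all_iff.2 fun j =>
      measure_eq_zero_iff_ae_notMem.1 (uniformSiteLaw_neverMeet x j)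
  obtain ⟨u, ⟨n, hn, hun, -⟩, ⟨m, hm, hum⟩, hu⟩ := ((ae_exists_biPercolates hp).and
    ((ae_exists_percolates_gt_half hp).and hmeet)).exists
  refine hu (-m, -m) (n + m).toNat ?_
  have e : ((-m : ℤ) + ((n + m).toNat : ℤ), (-m : ℤ) + ((n + m).toNat : ℤ)) = (n, n) := by
    rw [Int.toNat_of_nonneg (by omega)]
    simp
  rw [e]
  have hdisj : Disjoint {z | u z < 1 / 2} {z | 1 / 2 < u z} := Set.disjoint_left.2 fun z hz => by
    simp only [mem_ofPred_eq] at hz ⊢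
    linarith
  exact nwStep_iterate_ne_of_percolates hdisj (x := (n, n)) (y := (-m, -m)) (by omega) (by omega)
    hun hum

/-- If the sites are closed with probability at most one half, then almost surely there is no
infinite oriented path of closed sites. -/
lemma ae_not_percolates_compl {p : ℝ} (hp : 1 / 2 ≤ p) : ∀ᵐ u ∂uniformSiteLaw, ∀ x,
    ¬ Percolates otspSteps {z | u z < p}ᶜ x ∧ ¬ Percolates otspStepsSE {z | u z < p}ᶜ x := by
  -- Ties at `1/2` must be discarded: closed means `≥`, while the reflected event has a strict
  -- inequality.
  have hhalf : ∀ᵐ u ∂uniformSiteLaw, ∀ x, u x ≠ 1 / 2 := ae_all_iff.2 fun x => by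
    have := uniformSiteLaw_eval (measurableSet_singleton (1 / 2 : ℝ)) x
    rw [measure_mono_null inter_subset_left (measure_singleton _)] at this
    exact measure_eq_zero_iff_ae_notMem.1 this
  have h0 : uniformSiteLaw {u | Percolates otspSteps {z | u z ∈ Ici (1 / 2)} (0, 0)} = 0 := by
    rw [measure_eq_zero_iff_ae_notMem]
    filter_upwards [measurePreserving_one_sub.quasiMeasurePreserving.ae
      (measure_eq_zero_iff_ae_notMem.1 uniformSiteLaw_percolates_half), hhalf] with u hu hu' hperc
    refine hu (Percolates.mono (fun z hz => ?_) hperc)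
    have := lt_of_le_of_ne hz (hu' z).symm
    simp only [mem_ofPred_eq]
    linarith
  have hNW : ∀ x, uniformSiteLaw {u | Percolates otspSteps {z | u z ∈ Ici (1 / 2)} x} = 0 :=
    fun x => (uniformSiteLaw_percolates_add _ measurableSet_Ici x).trans h0
  have hSE : ∀ x, uniformSiteLaw {u | Percolates otspStepsSE {z | u z ∈ Ici (1 / 2)} x} = 0 :=
    fun x => (uniformSiteLaw_percolates_add _ measurableSet_Ici x).trans
      ((uniformSiteLaw_percolates_swap _ measurableSet_Ici).trans h0)
  refine ae_all_iff.2 fun x => ?_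
  have hsub : ∀ u : ℤ × ℤ → ℝ, {z | u z < p}ᶜ ⊆ {z | u z ∈ Ici (1 / 2)} :=
    fun u z hz => hp.trans (not_lt.1 hz)
  filter_upwards [measure_eq_zero_iff_ae_notMem.1 (hNW x),
    measure_eq_zero_iff_ae_notMem.1 (hSE x)] with u h1 h2
  exact ⟨fun h => h1 (h.mono (hsub u)), fun h => h2 (h.mono (hsub u))⟩

/-! ### The critical probability -/

lemma otspTheta_eq (p : ℝ) :
    otspTheta p = uniformSiteLaw {u | Percolates otspSteps {z | u z < p} (0, 0)} := by
  simp only [otspTheta, otspCluster_orthantEnv, Percolates]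

lemma otspTheta_mono : Monotone otspTheta := fun p q hpq => by
  rw [otspTheta_eq, otspTheta_eq]
  exact measure_mono fun u hu => Percolates.mono (fun z hz => lt_of_lt_of_le hz hpq) hu

lemma otspTheta_one_pos : 0 < otspTheta 1 := by
  have hall : ∀ᵐ u ∂uniformSiteLaw, ∀ x, u x < 1 := ae_all_iff.2 fun x =>
    (mem_ae_iff_prob_eq_one (measurableSet_eval_lt 1 x)).2
      ((uniformSiteLaw_lt le_rfl x).trans ENNReal.ofReal_one)
  have huniv : Percolates otspSteps univ (0, 0) :=
    (percolates_swap univ (0, 0)).1 (percolates_of_forall_exists_succ (Z := univ) (by simp)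
      (fun z _ => ⟨(z.1 + 1, z.2), mem_univ _, sub_mem_otspStepsSE.2 (by simp)⟩) (mem_univ _))
  have : otspTheta 1 = 1 := by
    rw [otspTheta_eq, ← mem_ae_iff_prob_eq_one
      (measurableSet_percolates (measurableSet_eval_lt 1) _ _)]
    filter_upwards [hall] with u hu
    exact huniv.mono fun z _ => hu z
  rw [this]
  exact one_pos

lemma half_le_criticalProb : 1 / 2 ≤ criticalProb := by
  refine le_csInf ⟨1, ⟨zero_le_one, le_rfl⟩, otspTheta_one_pos⟩ ?_
  rintro p ⟨-, hp⟩
  by_contra! h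
  have := hp.trans_le (otspTheta_mono h.le)
  rw [otspTheta_eq, uniformSiteLaw_percolates_half] at this
  exact lt_irrefl _ this

lemma otspTheta_pos {p : ℝ} (hp : criticalProb < p) : 0 < otspTheta p := by
  have hne : {p : ℝ | p ∈ Icc (0 : ℝ) 1 ∧ 0 < otspTheta p}.Nonempty :=
    ⟨1, ⟨zero_le_one, le_rfl⟩, otspTheta_one_pos⟩
  obtain ⟨q, ⟨-, hq⟩, hqp⟩ := exists_lt_of_csInf_lt hne hp
  exact hq.trans_le (otspTheta_mono hqp.le)

/-! ### The boundary of a cluster contains sites that close when the parameter decreases -/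

/-- The outer boundary of the backward cluster of the origin. -/
def clusterBoundary (p : ℝ) (u : ℤ × ℤ → ℝ) : Set (ℤ × ℤ) :=
  outerBoundary (backwardCluster (sitesEnv {z | u z < p}) (0, 0))

/-- The event that the boundary of the backward cluster of the origin for `p` is infinite,
contains `x`, and consists of sites that are open for `q`. -/
def boundaryOpen (q p : ℝ) (x : ℤ × ℤ) : Set (ℤ × ℤ → ℝ) :=
  {u | x ∈ clusterBoundary p u ∧ (clusterBoundary p u).Infinite ∧
    clusterBoundary p u ⊆ {z | u z < q}}

lemma measurableSet_boundaryOpen (q p : ℝ) (x : ℤ × ℤ) : MeasurableSet (boundaryOpen q p x) := by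
  have hm : ∀ y, MeasurableSet {u | y ∈ clusterBoundary p u} := fun y =>
    measurableSet_mem_outerBoundary (measurableSet_eval_lt p) (0, 0) y
  have hsub : {u | clusterBoundary p u ⊆ {z | u z < q}} =
      ⋂ y, {u | y ∈ clusterBoundary p u}ᶜ ∪ {u | y ∈ {z | u z < q}} := by
    ext u
    simp only [mem_ofPred_eq, subset_def, mem_iInter, mem_union, mem_compl_iff, imp_iff_not_or]
  have hmsub : MeasurableSet {u | clusterBoundary p u ⊆ {z | u z < q}} := by
    rw [hsub]
    exact .iInter fun y => (hm y).compl.union (measurableSet_eval_lt q y)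
  exact (hm x).inter ((measurableSet_infinite hm).inter hmsub)

lemma setOf_update_lt {u : ℤ × ℤ → ℝ} {p : ℝ} (hp : 0 < p) {x : ℤ × ℤ} (hx : u x < p) :
    {z | Function.update u x 0 z < p} = {z | u z < p} := by
  ext z
  by_cases hz : z = x
  · subst hz
    simp [hp, hx]
  · simp [hz]

lemma clusterBoundary_update {u : ℤ × ℤ → ℝ} {p : ℝ} (hp : 0 < p) {x : ℤ × ℤ} (hx : u x < p) :
    clusterBoundary p (Function.update u x 0) = clusterBoundary p u := by
  rw [clusterBoundary, setOf_update_lt hp hx, clusterBoundary]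

/-- Almost surely, an infinite boundary of the cluster for `p` contains a site that is closed
for `q < p`. -/
lemma ae_not_clusterBoundary_subset {q p : ℝ} (hq : 0 < q) (hqp : q < p) (hp : p ≤ 1) :
    ∀ᵐ u ∂uniformSiteLaw, (clusterBoundary p u).Infinite →
      ¬ clusterBoundary p u ⊆ {z | u z < q} := by
  -- `M x` ignores the variable at `x`. On `R x`, the site `x` is the only boundary site with value
  -- at least `q`, so the events `R x` are disjoint. By independence their summable probabilities
  -- are `p - q` times those of `M x`, and Borel–Cantelli applies to `boundaryOpen q p x ⊆ M x`.
  let M : ℤ × ℤ → Set (ℤ × ℤ → ℝ) := fun x => {u | Function.update u x 0 ∈ boundaryOpen q p x}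
  let R : ℤ × ℤ → Set (ℤ × ℤ → ℝ) := fun x => {u | u x ∈ Ico q p} ∩ M x
  have hMm : ∀ x, MeasurableSet (M x) := fun x => by
    refine measurableSet_boundaryOpen q p x |>.preimage (measurable_pi_lambda _ fun z => ?_)
    by_cases hz : z = x
    · subst hz
      simp
    · simpa [hz] using measurable_pi_apply z
  have hIm : ∀ x, MeasurableSet {u : ℤ × ℤ → ℝ | u x ∈ Ico q p} := fun x =>
    measurable_pi_apply x measurableSet_Ico
  have hR : ∀ x, uniformSiteLaw (R x) = ENNReal.ofReal (p - q) * uniformSiteLaw (M x) := fun x => by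
    rw [uniformSiteLaw_inter (T := {x}) (T' := {x}ᶜ) disjoint_compl_right (hIm x) (hMm x)
      (fun u v huv => by simp only [mem_ofPred_eq, huv x rfl])
      (fun u v huv => ?_), uniformSiteLaw_eval measurableSet_Ico,
      inter_eq_left.2 (Ico_subset_Icc_self.trans (Icc_subset_Icc hq.le hp)), Real.volume_Ico]
    have : Function.update u x 0 = Function.update v x 0 := by
      ext z
      by_cases hz : z = x
      · subst hz
        simp
      · simpa [hz] using huv z hz
    simp only [M, mem_ofPred_eq, this]
  have hdisj : Pairwise (Function.onFun Disjoint R) := by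
    intro x y hxy
    refine Set.disjoint_left.2 fun u hux huy => ?_
    obtain ⟨⟨-, hx⟩, -, -, hsub⟩ := hux
    obtain ⟨⟨hy, hy'⟩, hmem, -⟩ := huy
    rw [clusterBoundary_update (hq.trans hqp) hx] at hsub
    rw [clusterBoundary_update (hq.trans hqp) hy'] at hmem
    have := hsub hmem
    simp only [mem_ofPred_eq, Function.update_of_ne hxy.symm] at this
    exact not_lt.2 hy this
  have hsumR : ∑' x, uniformSiteLaw (R x) ≤ 1 :=
    (tsum_measure_le_measure_univ (fun x => ((hIm x).inter (hMm x)).nullMeasurableSet)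
      fun x y hxy => (hdisj hxy).aedisjoint).trans_eq measure_univ
  have hsumM : ∑' x, uniformSiteLaw (M x) ≠ ⊤ := by
    simp only [hR, ENNReal.tsum_mul_left] at hsumR
    intro h
    rw [h, ENNReal.mul_top (by simpa using hqp)] at hsumR
    simp at hsumR
  have hLM : ∀ x, boundaryOpen q p x ⊆ M x := fun x u hu => by
    have hx : u x < q := hu.2.2 hu.1
    have h1 := clusterBoundary_update (hq.trans hqp) (hx.trans hqp)
    refine ⟨h1 ▸ hu.1, h1 ▸ hu.2.1, ?_⟩
    rw [h1, setOf_update_lt hq hx]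
    exact hu.2.2
  have hsumL : ∑' x, uniformSiteLaw (boundaryOpen q p x) ≠ ⊤ :=
    ne_top_of_le_ne_top hsumM (ENNReal.tsum_le_tsum fun x => measure_mono (hLM x))
  filter_upwards [ae_finite_setOfPred_mem hsumL] with u hu hinf hsub
  -- If the whole boundary were below `q`, the event would occur at each of its infinitely many
  -- sites.
  exact hinf (hu.subset fun x hx => ⟨hx, hinf, hsub⟩)

/-! ### The main result -/

/-- For the site variables under their canonical law: if the backward cluster of the origin for
`p₁` is infinite, then it strictly contains the backward cluster for `p₂`. -/
lemma ae_backwardCluster_ssubset {p₁ p₂ : ℝ} (hp₁ : criticalProb ≤ p₁) (hp₁₂ : p₁ < p₂)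
    (hp₂ : p₂ ≤ 1) : ∀ᵐ u ∂uniformSiteLaw,
      (backwardCluster (sitesEnv {z | u z < p₁}) (0, 0)).Infinite →
        backwardCluster (sitesEnv {z | u z < p₂}) (0, 0) ⊂
          backwardCluster (sitesEnv {z | u z < p₁}) (0, 0) := by
  have hhalf : 1 / 2 ≤ p₁ := half_le_criticalProb.trans hp₁
  have hpos := otspTheta_pos (hp₁.trans_lt hp₁₂)
  rw [otspTheta_eq] at hpos
  filter_upwards [ae_not_percolates_compl hhalf, ae_exists_biPercolates hpos,
    ae_not_clusterBoundary_subset (by linarith) hp₁₂ hp₂] with u hclosed hopen hbdry hinf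
  have hupper : IsUpperSet (backwardCluster (sitesEnv {z | u z < p₁}) (0, 0))ᶜ := by
    by_contra h
    obtain ⟨x, hx | hx⟩ := exists_percolates_compl hinf h
    · exact (hclosed x).1 hx
    · exact (hclosed x).2 hx
  have hsub := backwardCluster_subset_of_isUpperSet hupper
    (T := {z | u z < p₂}) fun z hz => lt_trans hz hp₁₂
  refine hsub.ssubset_of_ne fun heq => ?_
  obtain ⟨n, hn, hNW, hSE⟩ := hopen
  have hnot := notMem_backwardCluster_of_percolates hn hNW hSE
  rw [heq] at hnot
  have hb : clusterBoundary p₂ u =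
      outerBoundary (backwardCluster (sitesEnv {z | u z < p₁}) (0, 0)) := by
    rw [clusterBoundary, heq]
  rw [hb] at hbdry
  exact hbdry (outerBoundary_infinite hupper (self_mem_backwardCluster _ _) hnot)
    (forwardClosed_compl_backwardCluster _ _).outerBoundary_subset

/-- For the two-dimensional orthant model, coupled for all `p` through i.i.d. uniform site
variables `U x`, and `p_c ≤ p₁ < p₂ ≤ 1`: almost surely, if the backward cluster of the origin
for `p₁` is infinite, then it strictly contains the backward cluster of the origin for `p₂`. -/
theorem mainTheorem9 {Ω : Type*} [MeasurableSpace Ω] (P : Measure Ω) [IsProbabilityMeasure P]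
    (U : ℤ × ℤ → Ω → ℝ) (hU_meas : ∀ x, Measurable (U x)) (hU_indep : iIndepFun U P)
    (hU_unif : ∀ x, pdf.IsUniform (U x) (Icc (0 : ℝ) 1) P volume)
    (p₁ p₂ : ℝ) (hp₁ : criticalProb ≤ p₁) (hp₁₂ : p₁ < p₂) (hp₂ : p₂ ≤ 1) :
    ∀ᵐ ω ∂P,
      (backwardCluster (orthantEnv (fun x => U x ω) p₁) (0, 0)).Infinite →
        backwardCluster (orthantEnv (fun x => U x ω) p₂) (0, 0) ⊂
          backwardCluster (orthantEnv (fun x => U x ω) p₁) (0, 0) := by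
  have hlaw : P.map (fun ω x => U x ω) = uniformSiteLaw := by
    rw [hU_indep.map_fun_eq_infinitePi_map hU_meas, uniformSiteLaw]
    exact congrArg _ (funext hU_unif)
  have h := ae_backwardCluster_ssubset hp₁ hp₁₂ hp₂
  rw [← hlaw] at h
  simp only [orthantEnv_eq_sitesEnv]
  exact ae_of_ae_map (measurable_pi_lambda _ hU_meas).aemeasurable h
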